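/- Let $N\ge 1$ agents have continuously differentiable $f_i:\mathbb R^K\to\mathbb R$ with average $f=\frac1N\sum_i f_i>\underline f$ on $\mathbb R^K$. For every compact $X\subset\mathbb R^K$ let $\nabla f$ and $\nabla f_i$ be Lipschitz on $X$ with constants $L(X)>0$ and $L_i(X)\ge 1$, monotone in $X$, and put $\hat L(X)=\max_i L_i(X)\ge L(X)$. Let $\mathbf W$ be a symmetric mixing matrix of an undirected graph on the agents: $W_{ij}>0$ if $i,j$ are neighbours, $W_{ij}=0$ if $i\ne j$ are not, $W_{ii}\ge0$, $\mathrm{Null}(I-\mathbf W)=\mathrm{span}\{\mathbf 1\}$, $-I\preceq\mathbf W\preceq I$, and $\eta:=\|\mathbf W-\frac1N\mathbf 1\mathbf 1^T\|<1$ (spectral norm). Let $\gamma,\xi>0$, $(1+\gamma)\eta^2<1$, $(1+\xi)\eta^2<1$. A bar denotes the average over agents, and norms of stacked vectors are Euclidean. MAGENTA with accuracy parameter $\delta>0$ and radius increment $d>0$ starts from $\mathbf x_i(0)$, $\mathbf y_i(0)=\nabla f_i(\mathbf x_i(0))$, puts $z=\bar{\mathbf x}(0)$, and runs stages $t=0,1,2,\dots$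 with $X(t)=B(td,z)$ (closed ball of radius $v^t=td$), $\hat L(t)=\hat L(X(t))$, $$\alpha(t)=\min\Big\{\tfrac1{8N}\Big(\tfrac{\hat L(t)}{2N}+\tfrac1\gamma+\tfrac54\Big)^{-1},\ \tfrac{N(1-(1+\gamma)\eta^2)(1-(1+\xi)\eta^2)}{64(1+1/\xi)\hat L(t)^2},\ 1\Big\},\qquad R(t)=\lceil 1/(\delta\alpha(t))\rceil .$$ Stage $t$ starts from the final iterate of the previous stage and performs $R(t)$ inner iterations $$\tilde{\mathbf x}_i^{r+1}=\arg\min_{u\in X(t)}\langle\mathbf y_i^r,u-\mathbf x_i^r\rangle+\tfrac1{2\alpha(t)}\|u-\mathbf x_i^r\|^2,\quad \mathbf x_i^{r+1}=\sum_jW_{ij}\big(\mathbf x_j^r+\tfrac12(\tilde{\mathbf x}_j^{r+1}-\mathbf x_j^r)\big),\quad \mathbf y_i^{r+1}=\sum_jW_{ij}\mathbf y_j^r+\nabla f_i(\mathbf x_i^{r+1})-\nabla f_i(\mathbf x_i^r),$$ each of which costs every agent one communication round and two local gradient evaluations (plus one evaluation at the start). Let $$\text{avg-gap}(t)=\frac1{R(t)}\sum_{r=0}^{R(t)-1}\big(\|\mathbf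 y^r\|^2+\|\mathbf x^r-\mathbf 1\bar{\mathbf x}^r\|^2+\|\mathbf y^r-\mathbf 1\bar{\mathbf y}^r\|^2\big)$$ for the iterates of stage $t$, let $\mathrm{gr}(v)=\max\{L(B(v,z)),\hat L(B(v,z))^2\}$, and let $\Delta=\Delta(d,\delta)=P(\mathbf w^0;1)-\underline f$, where $$P(\mathbf w^0;1)=f(\bar{\mathbf x})+\|\mathbf x-\mathbf 1\bar{\mathbf x}\|^2+\frac{1-(1+\gamma)\eta^2}{32(1+1/\xi)\hat L(1)^2}\|\mathbf y-\mathbf 1\bar{\mathbf y}\|^2$$ at the beginning of stage $1$. Below, $d>0$, $0<\epsilon<2(1-(1+\gamma)\eta^2)$ and $\mathbf x_i(0)\in B(d,z)$ for all $i$. The cost of $T$ stages means the number of communication rounds, and likewise the number of local gradient evaluations per agent, made by the end of stage $T$ (stage $0$ included). (1) There is a constant $C_0$ depending only on $N,\eta,\gamma,\xi$ such that, with $\delta=\epsilon$ and $T^*=\lceil 128\Delta/(\epsilon d^2)\rceil$, some stage $t\in[1,T^*]$ has $\text{avg-gap}(t)\le C_0\Delta\,\epsilon$, and the cost of $T^*$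 stages is at most $C_0\,T^*\,\frac1\epsilon\,\mathrm{gr}(d\,T^*)$. (2) There are constants $\kappa,C,C_1>0$, independent of $d$ and $\epsilon$ (they may depend on the problem, $\mathbf W$, $\gamma$, $\xi$ and $\mathbf x(0)$), such that, with $\delta=\kappa\epsilon$ and $T=\lceil C/(\epsilon d^2)\rceil$, some stage $t\in[1,T]$ has $\text{avg-gap}(t)\le\epsilon$, and the cost of $T$ stages is at most $C_1\,T\,\frac1\epsilon\,\mathrm{gr}(d\,T)$. (3) Suppose in addition that every $f_i$ is a polynomial of total degree at most $Q$, $Q\ge2$, and that each $L_i(X)$ is the smallest Lipschitz constant $\ge 1$ of $\nabla f_i$ on $X$. Then for $d=1/\sqrt\epsilon$ the quantities $T^*\frac1\epsilon\mathrm{gr}(dT^*)$ of (1) and $T\frac1\epsilon\mathrm{gr}(dT)$ of (2), and the costs in (1) and (2), are $O(1/\epsilon^{Q-1})$ (and the gap in (1) is $O(\epsilon)$), with constants independent of $\epsilon$. -/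

import Mathlib

open scoped BigOperators

noncomputable section

namespace Magenta

/-- The space `ℝ^K` with the Euclidean norm. -/
abbrev Vec (K : ℕ) : Type := EuclideanSpace ℝ (Fin K)

/-- The average `x̄ = (1/N) ∑ᵢ xᵢ` of the blocks of a stacked vector. -/
def mean {N K : ℕ} (x : Fin N → Vec K) : Vec K := (1 / (N : ℝ)) • ∑ i, x i

/-- The squared `ℓ²` norm of a stacked vector. -/
def sqNorm {N K : ℕ} (x : Fin N → Vec K) : ℝ := ∑ i, ‖x i‖ ^ 2

/-- The squared consensus error `‖x - 𝟏 x̄‖²`. -/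
def consErr {N K : ℕ} (x : Fin N → Vec K) : ℝ := sqNorm fun i => x i - mean x

/-- The average objective `f(u) = (1/N) ∑ᵢ fᵢ(u)`. -/
def avgFun {N K : ℕ} (f : Fin N → Vec K → ℝ) (u : Vec K) : ℝ := (1 / (N : ℝ)) * ∑ i, f i u

/-- `g` is Lipschitz on `X` with constant `ℓ`. -/
def LipOn {K : ℕ} (g : Vec K → Vec K) (ℓ : ℝ) (X : Set (Vec K)) : Prop :=
  ∀ y ∈ X, ∀ z ∈ X, ‖g y - g z‖ ≤ ℓ * ‖y - z‖

/-- `L̂(X) = maxᵢ Lᵢ(X)`. -/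
def Lhat {N K : ℕ} (Li : Fin N → Set (Vec K) → ℝ) (X : Set (Vec K)) : ℝ := ⨆ i, Li i X

/-- The growth function `gr(v) = max {L(B(v,z)), L̂(B(v,z))²}` of the Lipschitz constants on
the balls with centre `z`. -/
def gr {N K : ℕ} (L : Set (Vec K) → ℝ) (Li : Fin N → Set (Vec K) → ℝ) (z : Vec K) (v : ℝ) : ℝ :=
  max (L (Metric.closedBall z v)) (Lhat Li (Metric.closedBall z v) ^ 2)

/-- Assumptions on the problem: continuously differentiable local functions whose gradients, as
well as that of the average, are Lipschitz on each compact set `X` with constants `Lᵢ(X) ≥ 1`,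
`0 < L(X) ≤ L̂(X)`, monotone in `X`; the average function is bounded below by `flow`. -/
structure ProblemAssumption {N K : ℕ} (f : Fin N → Vec K → ℝ) (L : Set (Vec K) → ℝ)
    (Li : Fin N → Set (Vec K) → ℝ) (flow : ℝ) : Prop where
  contDiff : ∀ i, ContDiff ℝ 1 (f i)
  lip_avg : ∀ X, IsCompact X → LipOn (gradient (avgFun f)) (L X) X
  lip_local : ∀ i X, IsCompact X → LipOn (gradient (f i)) (Li i X) X
  L_pos : ∀ X, IsCompact X → 0 < L X
  one_le_Li : ∀ i X, IsCompact X → 1 ≤ Li i X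
  L_mono : ∀ X Y, IsCompact X → IsCompact Y → X ⊆ Y → L X ≤ L Y
  Li_mono : ∀ i X Y, IsCompact X → IsCompact Y → X ⊆ Y → Li i X ≤ Li i Y
  L_le_Lhat : ∀ X, IsCompact X → L X ≤ Lhat Li X
  lower : ∀ u, flow < avgFun f u

/-- The constants `Lᵢ(X)` are the smallest Lipschitz constants `≥ 1` of `∇ fᵢ` on compact sets. -/
def SharpConstants {N K : ℕ} (f : Fin N → Vec K → ℝ) (Li : Fin N → Set (Vec K) → ℝ) : Prop :=
  ∀ i X, IsCompact X → ∀ ℓ : ℝ, 1 ≤ ℓ → LipOn (gradient (f i)) ℓ X → Li i X ≤ ℓ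

/-- The contraction factor `η = ‖W - (1/N) 𝟏𝟏ᵀ‖` (spectral norm); for a mixing matrix this is
the second largest modulus of an eigenvalue of `W`. -/
def eta {N : ℕ} (W : Matrix (Fin N) (Fin N) ℝ) : ℝ :=
  ‖Matrix.toEuclideanCLM (n := Fin N) (𝕜 := ℝ) (W - Matrix.of fun _ _ => 1 / (N : ℝ))‖

/-- Assumptions on the mixing matrix of the undirected graph `G`. -/
structure MixingMatrix {N : ℕ} (G : SimpleGraph (Fin N)) (W : Matrix (Fin N) (Fin N) ℝ) :
    Prop where
  symm : W.IsSymm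
  ker : LinearMap.ker (Matrix.toLin' (1 - W)) = Submodule.span ℝ {fun _ => (1 : ℝ)}
  le_one : (1 - W).PosSemidef
  neg_one_le : (1 + W).PosSemidef
  pos : ∀ i j, G.Adj i j → 0 < W i j
  zero : ∀ i j, i ≠ j → ¬ G.Adj i j → W i j = 0
  diag : ∀ i, 0 ≤ W i i
  eta_lt_one : eta W < 1

/-- A state of the network: the local variables `xᵢ`, the gradient trackers `yᵢ`, the number of
communication rounds performed so far and the number of local gradient evaluations made so far
by each agent. -/
structure State (N K : ℕ) where
  x : Fin N → Vec K
  y : Fin N → Vec K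
  comm : ℕ
  grads : ℕ

/-- The objective `⟪y, u - x⟫ + ‖u - x‖² / (2α)` of the local projection step. -/
def localModel {K : ℕ} (α : ℝ) (x y u : Vec K) : ℝ :=
  inner ℝ y (u - x) + 1 / (2 * α) * ‖u - x‖ ^ 2

/-- The minimizer `x̃` of the local model over `X`. -/
def localArgmin {K : ℕ} (X : Set (Vec K)) (α : ℝ) (x y : Vec K) : Vec K :=
  Classical.epsilon fun u => u ∈ X ∧ IsMinOn (localModel α x y) X u

theorem localArgmin_spec {K : ℕ} {X : Set (Vec K)} (hX : IsCompact X) (hne : X.Nonempty)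
    (α : ℝ) (x y : Vec K) :
    localArgmin X α x y ∈ X ∧ IsMinOn (localModel α x y) X (localArgmin X α x y) := by
  have hc : ContinuousOn (localModel α x y) X := by
    unfold localModel
    fun_prop
  exact Classical.epsilon_spec (hX.exists_isMinOn hne hc)

/-- One inner iteration with feasible set `X` and stepsizes `α`, `β`: one communication round, and
the two local gradients `∇ fᵢ(xᵢ⁺)`, `∇ fᵢ(xᵢ)`. -/
def innerStep {N K : ℕ} (f : Fin N → Vec K → ℝ) (W : Matrix (Fin N) (Fin N) ℝ)
    (X : Set (Vec K)) (α β : ℝ) (s : State N K) : State N K :=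
  let v : Fin N → Vec K := fun i => localArgmin X α (s.x i) (s.y i) - s.x i
  let x' : Fin N → Vec K := fun i => ∑ j, W i j • (s.x j + β • v j)
  { x := x'
    y := fun i => ∑ j, W i j • s.y j + gradient (f i) (x' i) - gradient (f i) (s.x i)
    comm := s.comm + 1
    grads := s.grads + 2 }

/-- The data that determine a run of MAGENTA: local functions, mixing matrix, local Lipschitz
constants, parameters `γ`, `ξ`, radii `v^t`, accuracy parameter and initial point `x(0)`. -/
structure Input (N K : ℕ) where
  f : Fin N → Vec K → ℝ
  W : Matrix (Fin N) (Fin N) ℝ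
  Li : Fin N → Set (Vec K) → ℝ
  γ : ℝ
  ξ : ℝ
  v : ℕ → ℝ
  acc : ℝ
  x0 : Fin N → Vec K

namespace Input

variable {N K : ℕ} (A : Input N K)

/-- The feasible set `X(t) = B(v^t, z)` with `z = x̄(0)`. -/
def X (t : ℕ) : Set (Vec K) := Metric.closedBall (mean A.x0) (A.v t)

/-- `L̂(t) = L̂(X(t))`. -/
def Lh (t : ℕ) : ℝ := Lhat A.Li (A.X t)

/-- `1 - (1 + γ) η²`. -/
def a : ℝ := 1 - (1 + A.γ) * eta A.W ^ 2

/-- `1 - (1 + ξ) η²`. -/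
def b : ℝ := 1 - (1 + A.ξ) * eta A.W ^ 2

/-- The stepsize `α(t)`. -/
def α (t : ℕ) : ℝ :=
  min (min (1 / (8 * (N : ℝ)) * (1 / (A.Lh t / (2 * (N : ℝ)) + (1 / A.γ + 5 / 4))))
    ((N : ℝ) * A.a * A.b / (64 * (1 + 1 / A.ξ) * A.Lh t ^ 2))) 1

/-- The number `R(t) = 1 / (acc · α(t))`, rounded up, of inner iterations in stage `t`. -/
def R (t : ℕ) : ℕ := ⌈1 / (A.acc * A.α t)⌉₊

/-- The result of `r` inner iterations of stage `t`, started at `s`; here `β = 1/2`. -/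
def inner (t r : ℕ) (s : State N K) : State N K :=
  (innerStep A.f A.W (A.X t) (A.α t) (1 / 2))^[r] s

/-- The state at the beginning of stage `t`, that is, after the stages `0, …, t - 1`. -/
def state : ℕ → State N K
  | 0 => { x := A.x0, y := fun i => gradient (A.f i) (A.x0 i), comm := 0, grads := 1 }
  | t + 1 => A.inner t (A.R t) (state t)

/-- The `r`-th iterate of stage `t`. -/
def iter (t r : ℕ) : State N K := A.inner t r (A.state t)

/-- The averaged unconstrained stationarity gap of stage `t`. -/
def avgGap (t : ℕ) : ℝ :=
  1 / (A.R t : ℝ) * ∑ r ∈ Finset.range (A.R t),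
    (sqNorm (A.iter t r).y + consErr (A.iter t r).x + consErr (A.iter t r).y)

/-- The potential function `P(w; t)`. -/
def P (s : State N K) (t : ℕ) : ℝ :=
  avgFun A.f (mean s.x) + consErr s.x
    + A.a / (32 * (1 + 1 / A.ξ) * A.Lh t ^ 2) * consErr s.y

/-- Within the stages `1, …, T` the averaged gap of some stage is at most `tol`, and by the end of
stage `T` (with stage `0` included) each agent has taken part in at most `B` communication rounds
and has made at most `B` local gradient evaluations. -/
def ReachesWithin (T : ℕ) (tol B : ℝ) : Prop :=
  (∃ t, 1 ≤ t ∧ t ≤ T ∧ A.avgGap t ≤ tol) ∧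
    ((A.state (T + 1)).comm : ℝ) ≤ B ∧ ((A.state (T + 1)).grads : ℝ) ≤ B

end Input

/-- The data of a problem instance that do not depend on the radii and the accuracy. -/
structure Instance (N K : ℕ) where
  f : Fin N → Vec K → ℝ
  L : Set (Vec K) → ℝ
  Li : Fin N → Set (Vec K) → ℝ
  flow : ℝ
  W : Matrix (Fin N) (Fin N) ℝ
  x0 : Fin N → Vec K

namespace Instance

variable {N K : ℕ} (I : Instance N K)

/-- The run with radii `v^t = t d`, parameters `γ`, `ξ` and accuracy parameter `acc`. -/
def run (γ ξ d acc : ℝ) : Input N K :=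
  { f := I.f, W := I.W, Li := I.Li, γ := γ, ξ := ξ, v := fun t => (t : ℝ) * d,
    acc := acc, x0 := I.x0 }

/-- `P(w⁰; 1) - flow`, where `w⁰` is the state at the beginning of stage `1`. -/
def Δ (γ ξ d acc : ℝ) : ℝ :=
  (I.run γ ξ d acc).P ((I.run γ ξ d acc).state 1) 1 - I.flow

/-- The bound `T · (1/ε) · gr(d T)`. -/
def bound (d ε : ℝ) (T : ℕ) : ℝ :=
  (T : ℝ) * (1 / ε) * gr I.L I.Li (mean I.x0) (d * (T : ℝ))

/-- `d` and `ε` are positive, `ε < 2 (1 - (1 + γ) η²)`, and the initial point lies in `X(1)`. -/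
def Admissible (γ d ε : ℝ) : Prop :=
  0 < d ∧ 0 < ε ∧ ε < 2 * (1 - (1 + γ) * eta I.W ^ 2) ∧
    ∀ i, I.x0 i ∈ Metric.closedBall (mean I.x0) d

/-- Every `fᵢ` is a polynomial of degree at most `Q`. -/
def IsPoly (Q : ℕ) : Prop :=
  ∀ i, ∃ p : MvPolynomial (Fin K) ℝ, p.totalDegree ≤ Q ∧
    ∀ u : Vec K, I.f i u = MvPolynomial.eval (fun k => u k) p

end Instance

/-- The number of stages `⌈M / (ε d²)⌉`. -/
def stages (M d ε : ℝ) : ℕ := ⌈M / (ε * d ^ 2)⌉₊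

end Magenta

end

/-!
Per inner iteration the potential `P(·; t)` drops by a multiple of
`‖x̃ - x‖² / α + ‖x - 𝟏 x̄‖² + ‖y - 𝟏 ȳ‖²`: consensus contracts by `η²`, the tracking property
`ȳ = (1/N) ∑ᵢ ∇ fᵢ(xᵢ)` turns the descent lemma into a decrease of `f(x̄)`, and the stepsize is
small enough to absorb the cross terms. Since `P ≥ f` is bounded below, some stage `t ≤ T` drops it
by at most `Δ / T`, which for `T ≥ 128 Δ / (ε d²)` confines the iterates of that stage: their mean
moves less than `d` in total, and consensus errors and search directions are small compared with
`d`. As the stage starts with mean in `X(t - 1)`, all projections are then interior to `X(t)`, so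
that `x̃ - x = -α y` and the drop controls the unconstrained gap. The cost is
`∑ R(t) ≈ ∑ 1 / (δ α(t))` with `1 / α(t) = O(L̂(t)²)`. In stage `0` the feasible set is a point and
`f(x̄)` is constant, which bounds `Δ` independently of `d` and `ε`. For polynomials of degree `Q`
one has `gr(v) = O(v^(2 (Q - 2)))`, and `d T = O(1 / √ε)` if `d = 1 / √ε`.
-/

noncomputable section

namespace Magenta

open scoped RealInnerProductSpace Gradient

theorem norm_add_sq_le_young {E : Type*} [SeminormedAddCommGroup E] {γ : ℝ} (hγ : 0 < γ)
    (u w : E) : ‖u + w‖ ^ 2 ≤ (1 + γ) * ‖u‖ ^ 2 + (1 + 1 / γ) * ‖w‖ ^ 2 := by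
  have htri : ‖u + w‖ ^ 2 ≤ (‖u‖ + ‖w‖) ^ 2 := by gcongr; exact norm_add_le u w
  have hgap : (1 + γ) * ‖u‖ ^ 2 + (1 + 1 / γ) * ‖w‖ ^ 2 - (‖u‖ + ‖w‖) ^ 2
      = (γ * ‖u‖ - ‖w‖) ^ 2 / γ := by field_simp; ring
  have : 0 ≤ (γ * ‖u‖ - ‖w‖) ^ 2 / γ := by positivity
  linarith

theorem mul_mul_le_add_of_sq_le {D A B : ℝ} (hA : 0 ≤ A) (hB : 0 ≤ B) (hD : D ^ 2 ≤ 4 * A * B)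
    (p q : ℝ) : D * p * q ≤ A * p ^ 2 + B * q ^ 2 := by
  refine le_of_abs_le (abs_le_of_sq_le_sq ?_ (by positivity))
  calc (D * p * q) ^ 2 = D ^ 2 * (p ^ 2 * q ^ 2) := by ring
    _ ≤ 4 * A * B * (p ^ 2 * q ^ 2) := by gcongr
    _ ≤ (A * p ^ 2 + B * q ^ 2) ^ 2 := by linarith [sq_nonneg (A * p ^ 2 - B * q ^ 2)]

theorem le_add_inner_gradient_add_of_segment {E : Type*} [NormedAddCommGroup E]
    [InnerProductSpace ℝ E] [CompleteSpace E] {g : E → ℝ} {ℓ : ℝ} {p q : E}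
    (hg : ∀ u ∈ segment ℝ p q, DifferentiableAt ℝ g u)
    (hlip : ∀ u ∈ segment ℝ p q, ‖∇ g u - ∇ g p‖ ≤ ℓ * ‖u - p‖) :
    g q ≤ g p + ⟪∇ g p, q - p⟫ + ℓ / 2 * ‖q - p‖ ^ 2 := by
  set w := q - p
  have hmem : ∀ s ∈ Set.Icc (0 : ℝ) 1, p + s • w ∈ segment ℝ p q := fun s hs => by
    rw [segment_eq_image']
    exact ⟨s, hs, rfl⟩
  have hline : ∀ s ∈ Set.Icc (0 : ℝ) 1,
      HasDerivAt (fun s : ℝ => g (p + s • w)) ⟪∇ g (p + s • w), w⟫ s := fun s hs => by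
    have hpath : HasDerivAt (fun s : ℝ => p + s • w) w s := by
      simpa using ((hasDerivAt_id s).smul_const w).const_add p
    exact (hg _ (hmem s hs)).hasGradientAt.hasFDerivAt.comp_hasDerivAt s hpath
  have hquad : ∀ s : ℝ, HasDerivAt (fun s : ℝ => g p + s * ⟪∇ g p, w⟫ + ℓ / 2 * s ^ 2 * ‖w‖ ^ 2)
      (⟪∇ g p, w⟫ + ℓ * s * ‖w‖ ^ 2) s := fun s => by
    have h := (((hasDerivAt_id s).mul_const ⟪∇ g p, w⟫).const_add (g p)).add
      ((((hasDerivAt_id s).pow 2).const_mul (ℓ / 2)).mul_const (‖w‖ ^ 2))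
    refine h.congr_deriv ?_
    simp only [id, Nat.add_one_sub_one, pow_one, Nat.cast_ofNat]
    ring
  have hderiv : ∀ s ∈ Set.Ico (0 : ℝ) 1,
      ⟪∇ g (p + s • w), w⟫ ≤ ⟪∇ g p, w⟫ + ℓ * s * ‖w‖ ^ 2 := fun s hs => by
    have hs' := hlip _ (hmem s ⟨hs.1, hs.2.le⟩)
    rw [add_sub_cancel_left, norm_smul, Real.norm_of_nonneg hs.1] at hs'
    have hcs : ⟪∇ g (p + s • w), w⟫ - ⟪∇ g p, w⟫ ≤ ℓ * (s * ‖w‖) * ‖w‖ := by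
      rw [← inner_sub_left]
      exact (real_inner_le_norm _ _).trans (by gcongr)
    linarith
  have h := image_le_of_deriv_right_le_deriv_boundary
    (fun s hs => (hline s hs).continuousAt.continuousWithinAt)
    (fun s hs => (hline s ⟨hs.1, hs.2.le⟩).hasDerivWithinAt) (by simp)
    (fun s _ => (hquad s).continuousAt.continuousWithinAt)
    (fun s _ => (hquad s).hasDerivWithinAt) hderiv (Set.right_mem_Icc.2 zero_le_one)
  simpa [w] using h

/-! ### Stacked vectors -/

section Stacked

variable {N K : ℕ}

theorem sqNorm_nonneg (u : Fin N → Vec K) : 0 ≤ sqNorm u :=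
  Finset.sum_nonneg fun _ _ => by positivity

theorem consErr_nonneg (u : Fin N → Vec K) : 0 ≤ consErr u := sqNorm_nonneg _

theorem norm_sq_le_sqNorm (u : Fin N → Vec K) (i : Fin N) : ‖u i‖ ^ 2 ≤ sqNorm u :=
  Finset.single_le_sum (f := fun i => ‖u i‖ ^ 2) (fun _ _ => by positivity) (Finset.mem_univ i)

theorem norm_sub_mean_sq_le_consErr (u : Fin N → Vec K) (i : Fin N) :
    ‖u i - mean u‖ ^ 2 ≤ consErr u :=
  norm_sq_le_sqNorm (fun i => u i - mean u) i

theorem mean_add (u w : Fin N → Vec K) : mean (fun i => u i + w i) = mean u + mean w := by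
  simp [mean, Finset.sum_add_distrib]

theorem mean_sub (u w : Fin N → Vec K) : mean (fun i => u i - w i) = mean u - mean w := by
  simp [mean, Finset.sum_sub_distrib, smul_sub]

theorem mean_smul (c : ℝ) (u : Fin N → Vec K) : mean (fun i => c • u i) = c • mean u := by
  simp [mean, ← Finset.smul_sum, smul_comm c]

theorem sqNorm_smul (c : ℝ) (u : Fin N → Vec K) :
    sqNorm (fun i => c • u i) = c ^ 2 * sqNorm u := by
  simp [sqNorm, norm_smul, mul_pow, Finset.mul_sum]

theorem consErr_smul (c : ℝ) (u : Fin N → Vec K) :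
    consErr (fun i => c • u i) = c ^ 2 * consErr u := by
  simp only [consErr, mean_smul, ← smul_sub, sqNorm_smul]

theorem sqNorm_add_le {γ : ℝ} (hγ : 0 < γ) (u w : Fin N → Vec K) :
    sqNorm (fun i => u i + w i) ≤ (1 + γ) * sqNorm u + (1 + 1 / γ) * sqNorm w := by
  simp only [sqNorm, Finset.mul_sum, ← Finset.sum_add_distrib]
  exact Finset.sum_le_sum fun i _ => norm_add_sq_le_young hγ _ _

theorem sqNorm_sub_le (u w : Fin N → Vec K) :
    sqNorm (fun i => u i - w i) ≤ 2 * sqNorm u + 2 * sqNorm w := by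
  have h := sqNorm_add_le one_pos u (fun i => - w i)
  have hneg : sqNorm (fun i => - w i) = sqNorm w := by simp only [sqNorm, norm_neg]
  simp only [hneg, ← sub_eq_add_neg] at h
  linarith

theorem consErr_add_le {γ : ℝ} (hγ : 0 < γ) (u w : Fin N → Vec K) :
    consErr (fun i => u i + w i) ≤ (1 + γ) * consErr u + (1 + 1 / γ) * consErr w := by
  simp only [consErr, mean_add, add_sub_add_comm]
  exact sqNorm_add_le hγ (fun i => u i - mean u) (fun i => w i - mean w)

theorem sum_inner_le_sqrt_mul_sqrt (u w : Fin N → Vec K) :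
    ∑ i, ⟪u i, w i⟫ ≤ √(sqNorm u) * √(sqNorm w) :=
  (Finset.sum_le_sum fun i _ => real_inner_le_norm (u i) (w i)).trans
    (Real.sum_mul_le_sqrt_mul_sqrt _ _ _)

variable [NeZero N]

theorem sum_eq_smul_mean (u : Fin N → Vec K) : ∑ i, u i = (N : ℝ) • mean u := by
  simp [mean, smul_smul, NeZero.ne]

theorem mean_const (p : Vec K) : mean (fun _ : Fin N => p) = p := by
  simp [mean, ← Nat.cast_smul_eq_nsmul ℝ, smul_smul, NeZero.ne]

theorem mean_mem {X : Set (Vec K)} (hX : Convex ℝ X) {u : Fin N → Vec K} (hu : ∀ i, u i ∈ X) :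
    mean u ∈ X := by
  rw [mean, Finset.smul_sum]
  exact hX.sum_mem (fun _ _ => by positivity) (by simp [NeZero.ne]) fun i _ => hu i

theorem sqNorm_eq_consErr_add (u : Fin N → Vec K) :
    sqNorm u = consErr u + N * ‖mean u‖ ^ 2 := by
  simp only [consErr, sqNorm, norm_sub_sq_real]
  rw [Finset.sum_add_distrib, Finset.sum_sub_distrib, ← Finset.mul_sum, ← sum_inner,
    sum_eq_smul_mean, real_inner_smul_left, real_inner_self_eq_norm_sq]
  simp only [Finset.sum_const, Finset.card_univ, Fintype.card_fin, nsmul_eq_mul]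
  ring

theorem consErr_le_sqNorm (u : Fin N → Vec K) : consErr u ≤ sqNorm u := by
  rw [sqNorm_eq_consErr_add]
  exact le_add_of_nonneg_right (by positivity)

theorem norm_mean_sq_le (u : Fin N → Vec K) : N * ‖mean u‖ ^ 2 ≤ sqNorm u := by
  rw [sqNorm_eq_consErr_add]
  exact le_add_of_nonneg_left (consErr_nonneg u)

theorem consErr_sub_const (u : Fin N → Vec K) (p : Vec K) :
    consErr (fun i => u i - p) = consErr u := by
  simp only [consErr, mean_sub, mean_const, sub_sub_sub_cancel_right]

end Stacked

/-! ### Mixing -/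

section Mixing

variable {N K : ℕ} {W : Matrix (Fin N) (Fin N) ℝ}

theorem MixingMatrix.nonneg {G : SimpleGraph (Fin N)} (hW : MixingMatrix G W) (i j : Fin N) :
    0 ≤ W i j := by
  obtain rfl | hij := eq_or_ne i j
  · exact hW.diag i
  · by_cases hG : G.Adj i j
    · exact (hW.pos i j hG).le
    · exact (hW.zero i j hij hG).ge

theorem MixingMatrix.mem_doublyStochastic {G : SimpleGraph (Fin N)} (hW : MixingMatrix G W) :
    W ∈ doublyStochastic ℝ (Fin N) := by
  have hone : W.mulVec 1 = 1 := by
    have hker : (1 : Fin N → ℝ) ∈ LinearMap.ker (Matrix.toLin' (1 - W)) := by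
      rw [hW.ker]
      exact Submodule.mem_span_singleton_self _
    rw [LinearMap.mem_ker, Matrix.toLin'_apply, Matrix.sub_mulVec, Matrix.one_mulVec,
      sub_eq_zero] at hker
    exact hker.symm
  refine _root_.mem_doublyStochastic.2 ⟨hW.nonneg, hone, ?_⟩
  rw [← Matrix.mulVec_transpose, hW.symm.eq, hone]

/-- The stacked vector `(W ⊗ I) u`: agent `i` receives the `W`-weighted combination of all
blocks. -/
def mix (W : Matrix (Fin N) (Fin N) ℝ) (u : Fin N → Vec K) : Fin N → Vec K :=
  fun i => ∑ j, W i j • u j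

theorem mix_add (W : Matrix (Fin N) (Fin N) ℝ) (u w : Fin N → Vec K) :
    mix W (fun i => u i + w i) = fun i => mix W u i + mix W w i := by
  funext i
  simp only [mix, smul_add, Finset.sum_add_distrib]

theorem mix_sub (W : Matrix (Fin N) (Fin N) ℝ) (u w : Fin N → Vec K) :
    mix W (fun i => u i - w i) = fun i => mix W u i - mix W w i := by
  funext i
  simp only [mix, smul_sub, Finset.sum_sub_distrib]

theorem mean_mix (hW : W ∈ doublyStochastic ℝ (Fin N)) (u : Fin N → Vec K) :
    mean (mix W u) = mean u := by
  unfold mean mix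
  rw [Finset.sum_comm]
  simp only [← Finset.sum_smul, sum_col_of_mem_doublyStochastic hW, one_smul]

theorem mix_const (hW : W ∈ doublyStochastic ℝ (Fin N)) (p : Vec K) :
    mix W (fun _ => p) = fun _ => p := by
  funext i
  simp only [mix, ← Finset.sum_smul, sum_row_of_mem_doublyStochastic hW, one_smul]

theorem mix_mem (hW : W ∈ doublyStochastic ℝ (Fin N)) {X : Set (Vec K)} (hX : Convex ℝ X)
    {u : Fin N → Vec K} (hu : ∀ i, u i ∈ X) (i : Fin N) : mix W u i ∈ X :=
  hX.sum_mem (fun _ _ => nonneg_of_mem_doublyStochastic hW)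
    (sum_row_of_mem_doublyStochastic hW i) fun j _ => hu j

theorem sqNorm_mix_le (hW : W ∈ doublyStochastic ℝ (Fin N)) (u : Fin N → Vec K) :
    sqNorm (mix W u) ≤ sqNorm u := by
  have hconv : ConvexOn ℝ Set.univ fun p : Vec K => ‖p‖ ^ 2 :=
    (convexOn_norm convex_univ).pow (fun _ _ => norm_nonneg _) 2
  calc sqNorm (mix W u) ≤ ∑ i, ∑ j, W i j * ‖u j‖ ^ 2 :=
        Finset.sum_le_sum fun i _ =>
          hconv.map_sum_le (fun _ _ => nonneg_of_mem_doublyStochastic hW)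
            (sum_row_of_mem_doublyStochastic hW i) fun _ _ => Set.mem_univ _
    _ = sqNorm u := by
        rw [Finset.sum_comm]
        simp only [← Finset.sum_mul, sum_col_of_mem_doublyStochastic hW, one_mul, sqNorm]

theorem sqNorm_mix_le_opNorm_sq_mul (A : Matrix (Fin N) (Fin N) ℝ) (u : Fin N → Vec K) :
    sqNorm (mix A u) ≤ ‖Matrix.toEuclideanCLM (n := Fin N) (𝕜 := ℝ) A‖ ^ 2 * sqNorm u := by
  have hcoord : ∀ w : Fin N → Vec K, sqNorm w = ∑ k, ∑ i, (w i k) ^ 2 := fun w => by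
    simp only [sqNorm, EuclideanSpace.real_norm_sq_eq]
    exact Finset.sum_comm
  rw [hcoord, hcoord, Finset.mul_sum]
  refine Finset.sum_le_sum fun k _ => ?_
  have h := pow_le_pow_left₀ (norm_nonneg _) ((Matrix.toEuclideanCLM (n := Fin N)
    (𝕜 := ℝ) A).le_opNorm (WithLp.toLp 2 fun i => u i k)) 2
  rw [mul_pow, EuclideanSpace.real_norm_sq_eq, EuclideanSpace.real_norm_sq_eq] at h
  simpa [mix, Matrix.mulVec, dotProduct] using h

theorem consErr_mix_le [NeZero N] (hW : W ∈ doublyStochastic ℝ (Fin N)) (u : Fin N → Vec K) :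
    consErr (mix W u) ≤ eta W ^ 2 * consErr u := by
  have hJ : ∀ w : Fin N → Vec K,
      mix (W - Matrix.of fun _ _ => 1 / (N : ℝ)) w = fun i => mix W w i - mean w := fun w => by
    funext i
    simp [mix, mean, sub_smul, Finset.sum_sub_distrib, Finset.smul_sum]
  have h := sqNorm_mix_le_opNorm_sq_mul (W - Matrix.of fun _ _ => 1 / (N : ℝ))
    (fun i => u i - mean u)
  simp only [hJ, mean_sub, mean_const, mix_sub, mix_const hW, sub_self, sub_zero] at h
  rwa [consErr, mean_mix hW]

end Mixing

/-! ### The local projection step -/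

section LocalProjection

variable {K : ℕ} {X : Set (Vec K)} {α : ℝ} {x y p : Vec K}

theorem localModel_eq (hα : 0 < α) (x y u : Vec K) :
    localModel α x y u = 1 / (2 * α) * ‖x - α • y - u‖ ^ 2 - α / 2 * ‖y‖ ^ 2 := by
  have hsplit : x - α • y - u = -((u - x) + α • y) := by abel
  rw [localModel, hsplit, norm_neg, norm_add_sq_real, real_inner_smul_right, norm_smul,
    real_inner_comm, Real.norm_of_nonneg hα.le]
  field_simp
  ring

-- Completing the square, `p` is the point of `X` nearest to `x - α y`.
theorem inner_sub_sub_nonpos_of_isMinOn (hX : Convex ℝ X) (hα : 0 < α) (hp : p ∈ X)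
    (hmin : IsMinOn (localModel α x y) X p) {u : Vec K} (hu : u ∈ X) :
    ⟪x - α • y - p, u - p⟫ ≤ 0 := by
  have hnear : ∀ w : X, ‖x - α • y - p‖ ≤ ‖x - α • y - w‖ := fun w => by
    have hpw := isMinOn_iff.1 hmin w w.2
    rw [localModel_eq hα, localModel_eq hα, sub_le_sub_iff_right] at hpw
    exact le_of_sq_le_sq (le_of_mul_le_mul_left hpw (by positivity)) (norm_nonneg _)
  have : Nonempty X := ⟨⟨p, hp⟩⟩
  refine (norm_eq_iInf_iff_real_inner_le_zero hX hp).1 (le_antisymm (le_ciInf hnear) ?_) u hu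
  exact ciInf_le ⟨0, Set.forall_mem_range.2 fun _ => norm_nonneg _⟩ (⟨p, hp⟩ : X)

theorem inner_sub_le_of_isMinOn (hX : Convex ℝ X) (hα : 0 < α) (hx : x ∈ X) (hp : p ∈ X)
    (hmin : IsMinOn (localModel α x y) X p) : ⟪y, p - x⟫ ≤ -(1 / α) * ‖p - x‖ ^ 2 := by
  have h := inner_sub_sub_nonpos_of_isMinOn hX hα hp hmin hx
  have hexp : ⟪x - α • y - p, x - p⟫ = ‖p - x‖ ^ 2 + α * ⟪y, p - x⟫ := by
    rw [show x - α • y - p = -((p - x) + α • y) by abel, ← neg_sub p x, inner_neg_neg,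
      inner_add_left, real_inner_self_eq_norm_sq, real_inner_smul_left]
  rw [hexp] at h
  rw [neg_mul, one_div_mul_eq_div, ← neg_div, le_div_iff₀ hα]
  linarith

theorem sub_eq_neg_smul_of_isMinOn_of_mem_interior (hX : Convex ℝ X) (hα : 0 < α)
    (hp : p ∈ interior X) (hmin : IsMinOn (localModel α x y) X p) : p - x = -(α • y) := by
  set v := x - α • y - p with hv
  have hmax : IsMaxOn (innerSL ℝ v) X p := fun u hu => by
    have h := inner_sub_sub_nonpos_of_isMinOn hX hα (interior_subset hp) hmin hu
    rw [inner_sub_right, sub_nonpos] at h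
    exact h
  have hcrit : innerSL ℝ v = 0 :=
    (hmax.isLocalMax (mem_interior_iff_mem_nhds.1 hp)).hasFDerivAt_eq_zero
      (innerSL ℝ v).hasFDerivAt
  have hv0 : v = 0 := inner_self_eq_zero.1 (DFunLike.congr_fun hcrit v)
  rw [hv, sub_eq_zero] at hv0
  rw [← hv0]
  abel

end LocalProjection

/-! ### Lipschitz gradients -/

section Problem

variable {N K : ℕ} {f : Fin N → Vec K → ℝ} {L : Set (Vec K) → ℝ} {Li : Fin N → Set (Vec K) → ℝ}
  {flow : ℝ} {X : Set (Vec K)}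

theorem gradient_avgFun (hf : ∀ i, Differentiable ℝ (f i)) (u : Vec K) :
    ∇ (avgFun f) u = mean fun i => ∇ (f i) u := by
  have h : HasFDerivAt (avgFun f) ((1 / (N : ℝ)) • ∑ i, fderiv ℝ (f i) u) u :=
    (HasFDerivAt.fun_sum fun i _ => (hf i u).hasFDerivAt).const_mul _
  refine (hasGradientAt_iff_hasFDerivAt.2 ?_).gradient
  simpa [mean, gradient, map_sum] using h

theorem le_Lhat (Li : Fin N → Set (Vec K) → ℝ) (X : Set (Vec K)) (i : Fin N) :
    Li i X ≤ Lhat Li X :=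
  le_ciSup (Set.finite_range fun i => Li i X).bddAbove i

namespace ProblemAssumption

variable (hp : ProblemAssumption f L Li flow)

include hp

theorem differentiable (i : Fin N) : Differentiable ℝ (f i) :=
  (hp.contDiff i).differentiable one_ne_zero

theorem differentiable_avgFun : Differentiable ℝ (avgFun f) :=
  (Differentiable.fun_sum fun i _ => hp.differentiable i).const_mul _

theorem sqNorm_gradient_sub_le (hX : IsCompact X) {u w : Fin N → Vec K} (hu : ∀ i, u i ∈ X)
    (hw : ∀ i, w i ∈ X) :
    sqNorm (fun i => ∇ (f i) (u i) - ∇ (f i) (w i))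
      ≤ Lhat Li X ^ 2 * sqNorm (fun i => u i - w i) := by
  simp only [sqNorm, Finset.mul_sum, ← mul_pow]
  refine Finset.sum_le_sum fun i _ => pow_le_pow_left₀ (norm_nonneg _) ?_ 2
  exact (hp.lip_local i X hX _ (hu i) _ (hw i)).trans
    (mul_le_mul_of_nonneg_right (le_Lhat Li X i) (norm_nonneg _))

theorem avgFun_le_descent (hX : IsCompact X) (hXc : Convex ℝ X) {p q : Vec K} (hpX : p ∈ X)
    (hqX : q ∈ X) :
    avgFun f q ≤ avgFun f p + ⟪∇ (avgFun f) p, q - p⟫ + Lhat Li X / 2 * ‖q - p‖ ^ 2 := by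
  refine le_add_inner_gradient_add_of_segment (fun u _ => hp.differentiable_avgFun u)
    fun u hu => ?_
  exact (hp.lip_avg X hX u (hXc.segment_subset hpX hqX hu) p hpX).trans
    (mul_le_mul_of_nonneg_right (hp.L_le_Lhat X hX) (norm_nonneg _))

variable [NeZero N]

theorem one_le_Lhat (hX : IsCompact X) : 1 ≤ Lhat Li X :=
  (hp.one_le_Li 0 X hX).trans (le_Lhat Li X 0)

theorem Lhat_mono {Y : Set (Vec K)} (hX : IsCompact X) (hY : IsCompact Y) (hXY : X ⊆ Y) :
    Lhat Li X ≤ Lhat Li Y :=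
  ciSup_le fun i => (hp.Li_mono i X Y hX hY hXY).trans (le_Lhat Li Y i)

theorem sq_norm_gradient_avgFun_sub_mean_le (hX : IsCompact X) (hXc : Convex ℝ X)
    {u : Fin N → Vec K} (hu : ∀ i, u i ∈ X) :
    N * ‖∇ (avgFun f) (mean u) - mean fun i => ∇ (f i) (u i)‖ ^ 2
      ≤ Lhat Li X ^ 2 * consErr u := by
  rw [gradient_avgFun hp.differentiable, ← mean_sub]
  refine (norm_mean_sq_le _).trans ((hp.sqNorm_gradient_sub_le hX
    (fun _ => mean_mem hXc hu) hu).trans_eq ?_)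
  simp only [consErr, sqNorm, norm_sub_rev]

end ProblemAssumption

/-! ### One inner iteration -/

/-- The search direction `x̃ - x` of an inner iteration from the state `s`. -/
def dir (X : Set (Vec K)) (α : ℝ) (s : State N K) : Fin N → Vec K :=
  fun i => localArgmin X α (s.x i) (s.y i) - s.x i

/-- The invariant of gradient tracking: the average of the trackers is the average of the local
gradients. -/
def Tracks (f : Fin N → Vec K → ℝ) (s : State N K) : Prop :=
  mean s.y = mean fun i => ∇ (f i) (s.x i)

variable {W : Matrix (Fin N) (Fin N) ℝ} {α β : ℝ} {s : State N K}

theorem innerStep_x (f : Fin N → Vec K → ℝ) (W : Matrix (Fin N) (Fin N) ℝ) (X : Set (Vec K))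
    (α β : ℝ) (s : State N K) :
    (innerStep f W X α β s).x = mix W fun j => s.x j + β • dir X α s j := rfl

theorem innerStep_y (f : Fin N → Vec K → ℝ) (W : Matrix (Fin N) (Fin N) ℝ) (X : Set (Vec K))
    (α β : ℝ) (s : State N K) :
    (innerStep f W X α β s).y = fun i => mix W s.y i
      + (∇ (f i) ((innerStep f W X α β s).x i) - ∇ (f i) (s.x i)) :=
  funext fun _ => add_sub_assoc _ _ _

section DoublyStochastic

variable (hW : W ∈ doublyStochastic ℝ (Fin N))

include hW

theorem tracks_innerStep (hs : Tracks f s) : Tracks f (innerStep f W X α β s) := by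
  rw [Tracks, innerStep_y, mean_add, mean_mix hW, mean_sub, hs]
  abel

theorem mean_innerStep_x (X : Set (Vec K)) (α β : ℝ) (s : State N K) :
    mean (innerStep f W X α β s).x = mean s.x + β • mean (dir X α s) := by
  rw [innerStep_x, mean_mix hW, mean_add, mean_smul]

theorem innerStep_x_mem {Y : Set (Vec K)} (hX : IsCompact X) (hne : X.Nonempty)
    (hY : Convex ℝ Y) (hXY : X ⊆ Y) (hβ : β ∈ Set.Icc (0 : ℝ) 1) (hs : ∀ i, s.x i ∈ Y)
    (i : Fin N) : (innerStep f W X α β s).x i ∈ Y := by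
  rw [innerStep_x]
  refine mix_mem hW hY (fun j => ?_) i
  exact hY.add_smul_sub_mem (hs j) (hXY (localArgmin_spec hX hne α (s.x j) (s.y j)).1) hβ

theorem sqNorm_innerStep_x_sub_le (X : Set (Vec K)) (α β : ℝ) (s : State N K) :
    sqNorm (fun i => (innerStep f W X α β s).x i - s.x i)
      ≤ 8 * consErr s.x + 2 * β ^ 2 * sqNorm (dir X α s) := by
  set e : Fin N → Vec K := fun i => s.x i - mean s.x with he
  set w : Fin N → Vec K := fun i => β • dir X α s i
  have hdecomp : (fun i => (innerStep f W X α β s).x i - s.x i)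
      = fun i => (mix W e i - e i) + mix W w i := by
    rw [innerStep_x, mix_add, he, mix_sub, mix_const hW]
    funext i
    simp only
    abel
  have hconsensus : sqNorm (fun i => mix W e i - e i) ≤ 4 * consErr s.x := by
    have hmix : sqNorm (mix W e) ≤ consErr s.x := sqNorm_mix_le hW e
    have he' : sqNorm e = consErr s.x := rfl
    linarith [sqNorm_sub_le (mix W e) e]
  have hmove : sqNorm (mix W w) ≤ β ^ 2 * sqNorm (dir X α s) :=
    (sqNorm_mix_le hW w).trans_eq (sqNorm_smul _ _)
  rw [hdecomp]
  linarith [sqNorm_add_le one_pos (fun i => mix W e i - e i) (mix W w)]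

variable [NeZero N]

theorem consErr_innerStep_x_le {γ : ℝ} (hγ : 0 < γ) (X : Set (Vec K)) (α β : ℝ)
    (s : State N K) :
    consErr (innerStep f W X α β s).x ≤ (1 + γ) * eta W ^ 2 * consErr s.x
      + (1 + 1 / γ) * eta W ^ 2 * β ^ 2 * sqNorm (dir X α s) := by
  rw [innerStep_x]
  calc consErr (mix W fun j => s.x j + β • dir X α s j)
      ≤ eta W ^ 2 * consErr (fun j => s.x j + β • dir X α s j) := consErr_mix_le hW _
    _ ≤ eta W ^ 2 * ((1 + γ) * consErr s.x
          + (1 + 1 / γ) * (β ^ 2 * sqNorm (dir X α s))) := by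
        gcongr
        refine (consErr_add_le hγ _ _).trans ?_
        rw [consErr_smul]
        gcongr
        exact consErr_le_sqNorm _
    _ = _ := by ring

theorem consErr_innerStep_y_le (hp : ProblemAssumption f L Li flow) {Y : Set (Vec K)}
    (hY : IsCompact Y) {ξ : ℝ} (hξ : 0 < ξ) (hs : ∀ i, s.x i ∈ Y)
    (hs' : ∀ i, (innerStep f W X α β s).x i ∈ Y) :
    consErr (innerStep f W X α β s).y ≤ (1 + ξ) * eta W ^ 2 * consErr s.y
      + (1 + 1 / ξ) * Lhat Li Y ^ 2
        * sqNorm (fun i => (innerStep f W X α β s).x i - s.x i) := by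
  rw [innerStep_y, mul_assoc, mul_assoc]
  refine (consErr_add_le hξ _ _).trans ?_
  gcongr
  · exact consErr_mix_le hW _
  · exact (consErr_le_sqNorm _).trans (hp.sqNorm_gradient_sub_le hY hs' hs)

end DoublyStochastic

theorem sum_inner_dir_le (hX : IsCompact X) (hXc : Convex ℝ X) (hα : 0 < α)
    (hs : ∀ i, s.x i ∈ X) :
    ∑ i, ⟪s.y i, dir X α s i⟫ ≤ -(1 / α) * sqNorm (dir X α s) := by
  rw [sqNorm, Finset.mul_sum]
  refine Finset.sum_le_sum fun i _ => ?_
  have hmin := localArgmin_spec hX ⟨_, hs i⟩ α (s.x i) (s.y i)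
  exact inner_sub_le_of_isMinOn hXc hα (hs i) hmin.1 hmin.2

variable [NeZero N]

theorem inner_gradient_mean_dir_le (hp : ProblemAssumption f L Li flow) (hX : IsCompact X)
    (hXc : Convex ℝ X) (hα : 0 < α) (hs : ∀ i, s.x i ∈ X) (ht : Tracks f s) :
    N * ⟪∇ (avgFun f) (mean s.x), mean (dir X α s)⟫
      ≤ -(1 / α) * sqNorm (dir X α s) + √(consErr s.y) * √(sqNorm (dir X α s))
        + Lhat Li X * √(consErr s.x) * √(sqNorm (dir X α s)) := by
  set v := dir X α s
  set g := ∇ (avgFun f) (mean s.x) with hg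
  have hsplit : N * ⟪g, mean v⟫ = ∑ i, ⟪s.y i, v i⟫ + ∑ i, ⟪mean s.y - s.y i, v i⟫
      + ∑ i, ⟪g - mean s.y, v i⟫ := by
    rw [← real_inner_smul_right, ← sum_eq_smul_mean, inner_sum]
    simp only [← Finset.sum_add_distrib, ← inner_add_left, add_sub_cancel]
  have htracker : ∑ i, ⟪mean s.y - s.y i, v i⟫ ≤ √(consErr s.y) * √(sqNorm v) := by
    refine (sum_inner_le_sqrt_mul_sqrt _ _).trans_eq ?_
    simp only [consErr, sqNorm, norm_sub_rev]
  have hconsensus : ∑ i, ⟪g - mean s.y, v i⟫ ≤ Lhat Li X * √(consErr s.x) * √(sqNorm v) := by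
    refine (sum_inner_le_sqrt_mul_sqrt (fun _ => g - mean s.y) v).trans ?_
    have hLhat : 0 ≤ Lhat Li X := zero_le_one.trans (hp.one_le_Lhat hX)
    rw [← Real.sqrt_sq hLhat, ← Real.sqrt_mul (sq_nonneg _)]
    gcongr
    refine le_trans (le_of_eq ?_) (hp.sq_norm_gradient_avgFun_sub_mean_le hX hXc hs)
    simp [sqNorm, ← ht.symm, hg]
  linarith [sum_inner_dir_le (α := α) hX hXc hα hs]

theorem avgFun_innerStep_le (hW : W ∈ doublyStochastic ℝ (Fin N))
    (hp : ProblemAssumption f L Li flow) (hX : IsCompact X) (hXc : Convex ℝ X) (hα : 0 < α)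
    (hβ : β ∈ Set.Icc (0 : ℝ) 1) (hs : ∀ i, s.x i ∈ X) (ht : Tracks f s) :
    avgFun f (mean (innerStep f W X α β s).x) ≤ avgFun f (mean s.x)
      + β / N * (-(1 / α) * sqNorm (dir X α s) + √(consErr s.y) * √(sqNorm (dir X α s))
        + Lhat Li X * √(consErr s.x) * √(sqNorm (dir X α s)))
      + Lhat Li X * β ^ 2 / (2 * N) * sqNorm (dir X α s) := by
  have hN : (0 : ℝ) < N := Nat.cast_pos.2 (NeZero.pos N)
  have hdescent := hp.avgFun_le_descent hX hXc (mean_mem hXc hs)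
    (mean_mem hXc (innerStep_x_mem hW (f := f) (α := α) hX ⟨_, hs 0⟩ hXc subset_rfl hβ hs))
  rw [mean_innerStep_x hW, add_sub_cancel_left, real_inner_smul_right] at hdescent
  have hfirst := mul_le_mul_of_nonneg_left (inner_gradient_mean_dir_le hp hX hXc hα hs ht)
    (div_nonneg hβ.1 hN.le)
  rw [div_mul_eq_mul_div, mul_left_comm, mul_div_cancel_left₀ _ hN.ne'] at hfirst
  have hsecond : Lhat Li X / 2 * ‖β • mean (dir X α s)‖ ^ 2
      ≤ Lhat Li X * β ^ 2 / (2 * N) * sqNorm (dir X α s) := by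
    have hLhat : 0 ≤ Lhat Li X := zero_le_one.trans (hp.one_le_Lhat hX)
    calc Lhat Li X / 2 * ‖β • mean (dir X α s)‖ ^ 2
        = Lhat Li X * β ^ 2 / (2 * N) * (N * ‖mean (dir X α s)‖ ^ 2) := by
          rw [norm_smul, mul_pow, Real.norm_eq_abs, sq_abs]
          field_simp
      _ ≤ _ := by
          gcongr
          exact norm_mean_sq_le _
  rw [mean_innerStep_x hW]
  linarith

end Problem

namespace Input

variable {N K : ℕ}

section Basic

variable (A : Input N K)

/-- One inner iteration of stage `t`. -/
def next (t : ℕ) (s : State N K) : State N K := innerStep A.f A.W (A.X t) (A.α t) (1 / 2) s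

/-- The search direction of an inner iteration of stage `t` from the state `s`. -/
def searchDir (t : ℕ) (s : State N K) : Fin N → Vec K := dir (A.X t) (A.α t) s

/-- The weight of the tracking error `‖y - 𝟏 ȳ‖²` in the potential `P(·; t)`. -/
def wt (t : ℕ) : ℝ := A.a / (32 * (1 + 1 / A.ξ) * A.Lh t ^ 2)

/-- The amount by which an inner iteration of stage `t ≥ 1` from `s` decreases the potential. -/
def drop (t : ℕ) (s : State N K) : ℝ :=
  1 / (N * A.α t) / 4 * sqNorm (A.searchDir t s) + A.a / 2 * consErr s.x
    + A.wt t * A.b / 2 * consErr s.y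

/-- The amount by which the inner iterations of stage `t ≥ 1` decrease the potential. -/
def stageDrop (t : ℕ) : ℝ := ∑ r ∈ Finset.range (A.R t), A.drop t (A.iter t r)

theorem P_eq (s : State N K) (t : ℕ) :
    A.P s t = avgFun A.f (mean s.x) + consErr s.x + A.wt t * consErr s.y := rfl

theorem iter_zero (t : ℕ) : A.iter t 0 = A.state t := rfl

theorem iter_succ (t r : ℕ) : A.iter t (r + 1) = A.next t (A.iter t r) :=
  Function.iterate_succ_apply' _ _ _

theorem iter_R (t : ℕ) : A.iter t (A.R t) = A.state (t + 1) := rfl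

theorem isCompact_X (t : ℕ) : IsCompact (A.X t) := isCompact_closedBall _ _

theorem convex_X (t : ℕ) : Convex ℝ (A.X t) := convex_closedBall _ _

end Basic

/-- The assumptions on a problem, parameters and an initial point under which the run with radii
`v^t = t d` is analysed. -/
structure StandingAssumption (A : Input N K) (L : Set (Vec K) → ℝ) (flow d : ℝ) : Prop where
  γ_pos : 0 < A.γ
  ξ_pos : 0 < A.ξ
  a_pos : 0 < A.a
  b_pos : 0 < A.b
  mixing : A.W ∈ doublyStochastic ℝ (Fin N)
  problem : ProblemAssumption A.f L A.Li flow
  d_pos : 0 < d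
  v_eq : ∀ t, A.v t = t * d
  acc_pos : 0 < A.acc
  acc_lt : A.acc < 2 * A.a
  x0_mem : ∀ i, A.x0 i ∈ Metric.closedBall (mean A.x0) d

namespace StandingAssumption

variable {A : Input N K} {L : Set (Vec K) → ℝ} {flow d : ℝ} (h : A.StandingAssumption L flow d)

include h

theorem mean_x0_mem_X (t : ℕ) : mean A.x0 ∈ A.X t := by
  have := h.d_pos
  exact Metric.mem_closedBall_self (by rw [h.v_eq]; positivity)

theorem X_mono : Monotone A.X := fun s t hst => by
  have := h.d_pos
  refine Metric.closedBall_subset_closedBall ?_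
  rw [h.v_eq, h.v_eq]
  gcongr

theorem a_le_one : A.a ≤ 1 := by
  have := h.γ_pos
  exact sub_le_self _ (by positivity)

theorem b_le_one : A.b ≤ 1 := by
  have := h.ξ_pos
  exact sub_le_self _ (by positivity)

theorem acc_le_two : A.acc ≤ 2 := by linarith [h.acc_lt, h.a_le_one]

theorem eta_sq_le_one : eta A.W ^ 2 ≤ 1 := by
  have hγ := mul_nonneg h.γ_pos.le (sq_nonneg (eta A.W))
  have ha : 0 < 1 - (1 + A.γ) * eta A.W ^ 2 := h.a_pos
  linarith

theorem state_zero_x_mem (i : Fin N) : (A.state 0).x i ∈ A.X 1 := by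
  simpa [X, state, h.v_eq] using h.x0_mem i

theorem searchDir_stage_zero (s : State N K) :
    A.searchDir 0 s = fun i => mean A.x0 - s.x i := by
  funext i
  have hmem := (localArgmin_spec (A.isCompact_X 0) ⟨_, h.mean_x0_mem_X 0⟩ (A.α 0) (s.x i)
    (s.y i)).1
  have hz : localArgmin (A.X 0) (A.α 0) (s.x i) (s.y i) = mean A.x0 := by
    simpa only [X, h.v_eq, Nat.cast_zero, zero_mul, Metric.closedBall_zero,
      Set.mem_singleton_iff] using hmem
  exact congrArg (· - s.x i) hz

variable {s : State N K}

theorem next_x_mem {t : ℕ} {Y : Set (Vec K)} (hY : Convex ℝ Y) (hXY : A.X t ⊆ Y)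
    (hs : ∀ i, s.x i ∈ Y) : ∀ i, (A.next t s).x i ∈ Y :=
  innerStep_x_mem h.mixing (A.isCompact_X t) ⟨_, h.mean_x0_mem_X t⟩ hY hXY
    ⟨by norm_num, by norm_num⟩ hs

theorem iter_x_mem {t : ℕ} {Y : Set (Vec K)} (hY : Convex ℝ Y) (hXY : A.X t ⊆ Y)
    (hs : ∀ i, (A.state t).x i ∈ Y) (r : ℕ) : ∀ i, (A.iter t r).x i ∈ Y := by
  induction r with
  | zero => exact hs
  | succ r ih =>
    rw [iter_succ]
    exact h.next_x_mem hY hXY ih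

theorem state_succ_x_mem (t : ℕ) : ∀ i, (A.state (t + 1)).x i ∈ A.X (t + 1) := by
  induction t with
  | zero => exact h.iter_x_mem (A.convex_X 1) (h.X_mono zero_le_one) h.state_zero_x_mem (A.R 0)
  | succ t ih =>
    exact fun i => h.X_mono (Nat.le_succ (t + 1))
      (h.iter_x_mem (A.convex_X _) subset_rfl ih (A.R (t + 1)) i)

theorem iter_succ_x_mem (t r : ℕ) : ∀ i, (A.iter (t + 1) r).x i ∈ A.X (t + 1) :=
  h.iter_x_mem (A.convex_X _) subset_rfl (h.state_succ_x_mem t) r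

theorem tracks_iter (t r : ℕ) : Tracks A.f (A.iter t r) := by
  have hiter : ∀ t, Tracks A.f (A.state t) → ∀ r, Tracks A.f (A.iter t r) := fun t ht r => by
    induction r with
    | zero => exact ht
    | succ r ih =>
      rw [iter_succ]
      exact tracks_innerStep h.mixing ih
  induction t generalizing r with
  | zero => exact hiter 0 rfl r
  | succ t ih => exact hiter (t + 1) (ih (A.R t)) r

variable [NeZero N]

theorem one_le_Lh (t : ℕ) : 1 ≤ A.Lh t := h.problem.one_le_Lhat (A.isCompact_X t)

theorem Lh_mono : Monotone A.Lh := fun s t hst =>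
  h.problem.Lhat_mono (A.isCompact_X s) (A.isCompact_X t) (h.X_mono hst)

theorem wt_pos (t : ℕ) : 0 < A.wt t := by
  have := h.ξ_pos
  have := h.a_pos
  have := h.one_le_Lh t
  unfold wt
  positivity

theorem wt_anti : Antitone A.wt := fun s t hst => by
  have := h.ξ_pos
  have := h.a_pos
  have := h.one_le_Lh s
  have := h.Lh_mono hst
  unfold wt
  gcongr

theorem wt_mul (t : ℕ) : A.wt t * ((1 + 1 / A.ξ) * A.Lh t ^ 2) = A.a / 32 := by
  have := h.ξ_pos
  have := h.one_le_Lh t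
  unfold wt
  field_simp

/-! ### Stepsizes -/

theorem α_pos (t : ℕ) : 0 < A.α t := by
  have := h.γ_pos
  have := h.ξ_pos
  have := h.a_pos
  have := h.b_pos
  have := h.one_le_Lh t
  have : (0 : ℝ) < N := Nat.cast_pos.2 (NeZero.pos N)
  exact lt_min (lt_min (by positivity) (by positivity)) one_pos

theorem Lh_div_add_le (t : ℕ) :
    A.Lh t / (2 * N) + (1 / A.γ + 5 / 4) ≤ 1 / (N * A.α t) / 8 := by
  have := h.γ_pos
  have := h.one_le_Lh t
  have hN : (0 : ℝ) < N := Nat.cast_pos.2 (NeZero.pos N)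
  have hα := h.α_pos t
  have hle : A.α t ≤ _ := (min_le_left _ _).trans (min_le_left _ _)
  rw [mul_one_div, le_div_iff₀ (by positivity), le_div_iff₀ (by positivity)] at hle
  rw [div_div, le_div_iff₀ (by positivity)]
  linarith

theorem two_mul_α_le (t : ℕ) : 2 * A.α t ≤ N * A.wt t * A.b := by
  have := h.ξ_pos
  have := h.one_le_Lh t
  have hle : A.α t ≤ N * A.a * A.b / (64 * (1 + 1 / A.ξ) * A.Lh t ^ 2) :=
    (min_le_left _ _).trans (min_le_right _ _)
  calc 2 * A.α t ≤ 2 * (N * A.a * A.b / (64 * (1 + 1 / A.ξ) * A.Lh t ^ 2)) := by gcongr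
    _ = N * A.wt t * A.b := by
      unfold wt
      field_simp
      ring

theorem sixteen_mul_α_mul_le (t : ℕ) : 16 * A.α t * A.Lh t ^ 2 ≤ N * A.a := by
  have := h.ξ_pos
  have := h.a_pos
  have := h.wt_pos t
  have hα : 2 * A.α t ≤ N * A.wt t :=
    (h.two_mul_α_le t).trans (mul_le_of_le_one_right (by positivity) h.b_le_one)
  have hLh : A.Lh t ^ 2 ≤ (1 + 1 / A.ξ) * A.Lh t ^ 2 :=
    le_mul_of_one_le_left (by positivity) (le_add_of_nonneg_right (by positivity))
  calc 16 * A.α t * A.Lh t ^ 2 = 8 * (2 * A.α t * A.Lh t ^ 2) := by ring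
    _ ≤ 8 * (N * A.wt t * ((1 + 1 / A.ξ) * A.Lh t ^ 2)) := by
      gcongr 8 * ?_
      exact mul_le_mul hα hLh (by positivity) (by positivity)
    _ = N * A.a / 4 := by rw [mul_assoc (N : ℝ), h.wt_mul]; ring
    _ ≤ N * A.a := div_le_self (by positivity) (by norm_num)

theorem ten_mul_le_one (t : ℕ) : 10 * (N * A.α t) ≤ 1 := by
  have := h.γ_pos
  have := h.one_le_Lh t
  have hα := h.α_pos t
  have hN : (0 : ℝ) < N := Nat.cast_pos.2 (NeZero.pos N)
  have hle := h.Lh_div_add_le t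
  have : 0 ≤ A.Lh t / (2 * N) + 1 / A.γ := by positivity
  rw [← one_le_div₀ (by positivity), mul_comm, ← div_div]
  linarith

theorem ten_mul_α_le_one (t : ℕ) : 10 * A.α t ≤ 1 := by
  have hN : (1 : ℝ) ≤ N := Nat.one_le_cast.2 (NeZero.pos N)
  linarith [h.ten_mul_le_one t, le_mul_of_one_le_left (h.α_pos t).le hN]

/-! ### Decrease of the potential -/

theorem consErr_next_x_le (t : ℕ) (s : State N K) :
    consErr (A.next t s).x ≤ (1 - A.a) * consErr s.x
      + (1 + 1 / A.γ) * eta A.W ^ 2 / 4 * sqNorm (A.searchDir t s) := by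
  refine (consErr_innerStep_x_le h.mixing h.γ_pos _ _ _ s).trans_eq ?_
  unfold a searchDir
  ring

theorem wt_mul_consErr_next_y_le {t : ℕ} (hs : ∀ i, s.x i ∈ A.X t) :
    A.wt t * consErr (A.next t s).y ≤ (1 - A.b) * (A.wt t * consErr s.y)
      + A.a / 4 * consErr s.x + A.a / 64 * sqNorm (A.searchDir t s) := by
  have hwt := h.wt_pos t
  have hξ := h.ξ_pos
  set c := (1 + 1 / A.ξ) * A.Lh t ^ 2 with hc
  calc A.wt t * consErr (A.next t s).y
      ≤ A.wt t * ((1 + A.ξ) * eta A.W ^ 2 * consErr s.y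
        + c * (8 * consErr s.x + 2 * (1 / 2) ^ 2 * sqNorm (A.searchDir t s))) := by
        gcongr
        refine (consErr_innerStep_y_le h.mixing h.problem (A.isCompact_X t) hξ hs
          (h.next_x_mem (A.convex_X t) subset_rfl hs)).trans ?_
        have hmove := sqNorm_innerStep_x_sub_le (f := A.f) h.mixing (A.X t) (A.α t) (1 / 2) s
        rw [hc, Lh]
        gcongr
        exact hmove
    _ = (1 + A.ξ) * eta A.W ^ 2 * (A.wt t * consErr s.y)
        + A.wt t * c * (8 * consErr s.x + 1 / 2 * sqNorm (A.searchDir t s)) := by ring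
    _ = _ := by
        rw [hc, h.wt_mul]
        unfold b
        ring

theorem avgFun_next_le {t : ℕ} (hs : ∀ i, s.x i ∈ A.X t) (ht : Tracks A.f s) :
    avgFun A.f (mean (A.next t s).x) ≤ avgFun A.f (mean s.x)
      + (A.Lh t / (8 * N) - 1 / (N * A.α t) / 2) * sqNorm (A.searchDir t s)
      + 1 / (2 * N) * √(consErr s.y) * √(sqNorm (A.searchDir t s))
      + A.Lh t / (2 * N) * √(consErr s.x) * √(sqNorm (A.searchDir t s)) := by
  refine (avgFun_innerStep_le h.mixing h.problem (A.isCompact_X t) (A.convex_X t) (h.α_pos t)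
    ⟨by norm_num, by norm_num⟩ hs ht).trans_eq ?_
  have := (h.α_pos t).ne'
  rw [searchDir, Lh]
  field_simp
  ring

theorem tracker_cross_le (t : ℕ) (p q : ℝ) :
    1 / (2 * N) * p * q ≤ A.wt t * A.b / 2 * p ^ 2 + 1 / (N * A.α t) / 16 * q ^ 2 := by
  have hα := h.α_pos t
  have hwt := h.wt_pos t
  have hb := h.b_pos
  have hN : (0 : ℝ) < N := Nat.cast_pos.2 (NeZero.pos N)
  refine mul_mul_le_add_of_sq_le (by positivity) (by positivity) ?_ p q
  calc (1 / (2 * (N : ℝ))) ^ 2 = 2 * A.α t / (8 * N ^ 2 * A.α t) := by field_simp; norm_num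
    _ ≤ N * A.wt t * A.b / (8 * N ^ 2 * A.α t) :=
      div_le_div_of_nonneg_right (h.two_mul_α_le t) (by positivity)
    _ = 4 * (A.wt t * A.b / 2) * (1 / (N * A.α t) / 16) := by field_simp; norm_num

theorem consensus_cross_le (t : ℕ) (p q : ℝ) :
    A.Lh t / (2 * N) * p * q ≤ A.a / 4 * p ^ 2 + 1 / (N * A.α t) / 64 * q ^ 2 := by
  have hα := h.α_pos t
  have ha := h.a_pos
  have hN : (0 : ℝ) < N := Nat.cast_pos.2 (NeZero.pos N)
  refine mul_mul_le_add_of_sq_le (by positivity) (by positivity) ?_ p q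
  calc (A.Lh t / (2 * N)) ^ 2 = 16 * A.α t * A.Lh t ^ 2 / (64 * N ^ 2 * A.α t) := by
        field_simp; ring
    _ ≤ N * A.a / (64 * N ^ 2 * A.α t) :=
      div_le_div_of_nonneg_right (h.sixteen_mul_α_mul_le t) (by positivity)
    _ = 4 * (A.a / 4) * (1 / (N * A.α t) / 64) := by field_simp

theorem searchDir_coeff_le (t : ℕ) :
    A.Lh t / (8 * N) + (1 + 1 / A.γ) * eta A.W ^ 2 / 4 + A.a / 64 ≤ 1 / (N * A.α t) / 32 := by
  have hγ := h.γ_pos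
  have hη : (1 + 1 / A.γ) * eta A.W ^ 2 ≤ 1 + 1 / A.γ :=
    mul_le_of_le_one_right (by positivity) h.eta_sq_le_one
  have hLh : A.Lh t / (8 * N) = A.Lh t / (2 * N) / 4 := by ring
  linarith [h.Lh_div_add_le t, h.a_le_one]

theorem P_next_add_drop_le {t : ℕ} (hs : ∀ i, s.x i ∈ A.X t) (ht : Tracks A.f s) :
    A.P (A.next t s) t + A.drop t s ≤ A.P s t := by
  have hα := h.α_pos t
  have hV := sqNorm_nonneg (A.searchDir t s)
  have htracker := h.tracker_cross_le t √(consErr s.y) √(sqNorm (A.searchDir t s))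
  have hconsensus := h.consensus_cross_le t √(consErr s.x) √(sqNorm (A.searchDir t s))
  rw [Real.sq_sqrt (consErr_nonneg _), Real.sq_sqrt hV] at htracker hconsensus
  have hcoeff := mul_le_mul_of_nonneg_right (h.searchDir_coeff_le t) hV
  have hslack : 0 ≤ 1 / (N * A.α t) * sqNorm (A.searchDir t s) := by positivity
  rw [P_eq, P_eq, drop]
  linarith [h.avgFun_next_le hs ht, h.consErr_next_x_le t s, h.wt_mul_consErr_next_y_le hs]

theorem P_iter_add_sum_drop_le (t r : ℕ) :
    A.P (A.iter (t + 1) r) (t + 1) + ∑ k ∈ Finset.range r, A.drop (t + 1) (A.iter (t + 1) k)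
      ≤ A.P (A.state (t + 1)) (t + 1) := by
  induction r with
  | zero => simp [iter_zero]
  | succ r ih =>
    rw [Finset.sum_range_succ, iter_succ]
    linarith [h.P_next_add_drop_le (h.iter_succ_x_mem t r) (h.tracks_iter (t + 1) r)]

theorem P_anti (s : State N K) : Antitone (A.P s) := fun t t' htt' => by
  rw [P_eq, P_eq]
  gcongr
  · exact consErr_nonneg s.y
  · exact h.wt_anti htt'

theorem flow_lt_P (s : State N K) (t : ℕ) : flow < A.P s t := by
  have := mul_nonneg (h.wt_pos t).le (consErr_nonneg s.y)
  rw [P_eq]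
  linarith [h.problem.lower (mean s.x), consErr_nonneg s.x]

theorem P_state_add_sum_stageDrop_le (T : ℕ) :
    A.P (A.state (T + 1)) (T + 1) + ∑ t ∈ Finset.range T, A.stageDrop (t + 1)
      ≤ A.P (A.state 1) 1 := by
  induction T with
  | zero => simp
  | succ T ih =>
    have hstage : A.P (A.state (T + 2)) (T + 1) + A.stageDrop (T + 1) ≤ _ :=
      h.P_iter_add_sum_drop_le T (A.R (T + 1))
    rw [Finset.sum_range_succ]
    linarith [h.P_anti (A.state (T + 2)) (Nat.le_succ (T + 1))]

theorem exists_stageDrop_le {T : ℕ} (hT : 0 < T) :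
    ∃ t < T, T * A.stageDrop (t + 1) ≤ A.P (A.state 1) 1 - flow := by
  have hsum : ∑ t ∈ Finset.range T, T * A.stageDrop (t + 1)
      ≤ ∑ _t ∈ Finset.range T, (A.P (A.state 1) 1 - flow) := by
    rw [← Finset.mul_sum, Finset.sum_const, Finset.card_range, nsmul_eq_mul]
    gcongr
    linarith [h.P_state_add_sum_stageDrop_le T, h.flow_lt_P (A.state (T + 1)) (T + 1)]
  simpa using Finset.exists_le_of_sum_le (Finset.nonempty_range_iff.2 hT.ne') hsum

end StandingAssumption
end Input

theorem natCeil_one_div_mul_le {x : ℝ} (hx : 0 < x) : ⌈1 / x⌉₊ * x ≤ 1 + x := by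
  calc ⌈1 / x⌉₊ * x ≤ (1 / x + 1) * x := by
        gcongr
        exact (Nat.ceil_lt_add_one (by positivity)).le
    _ = 1 + x := by rw [add_mul, one_div_mul_cancel hx.ne', one_mul]

/-- The factor in the bound of the averaged gap by the decrease of the potential. -/
def gapConst (N : ℕ) (a : ℝ) : ℝ := 5 * N + 2 / a

theorem gapConst_pos {N : ℕ} [NeZero N] {a : ℝ} (ha : 0 < a) : 0 < gapConst N a := by
  have : (0 : ℝ) < N := Nat.cast_pos.2 (NeZero.pos N)
  unfold gapConst
  positivity

namespace Input.StandingAssumption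

variable {N K : ℕ} {A : Input N K} {L : Set (Vec K) → ℝ} {flow d : ℝ}
  (h : A.StandingAssumption L flow d) [NeZero N]

include h

/-! ### Number of inner iterations -/

theorem acc_mul_α_pos (t : ℕ) : 0 < A.acc * A.α t := mul_pos h.acc_pos (h.α_pos t)

theorem R_pos (t : ℕ) : 0 < A.R t := Nat.ceil_pos.2 (one_div_pos.2 (h.acc_mul_α_pos t))

theorem one_le_R_mul (t : ℕ) : 1 ≤ A.R t * (A.acc * A.α t) := by
  rw [← div_le_iff₀ (h.acc_mul_α_pos t)]
  exact Nat.le_ceil _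

theorem R_mul_le (t : ℕ) : A.R t * (A.acc * A.α t) ≤ 6 / 5 := by
  have hacc := mul_le_mul_of_nonneg_right h.acc_le_two (h.α_pos t).le
  have hceil : A.R t * (A.acc * A.α t) ≤ _ := natCeil_one_div_mul_le (h.acc_mul_α_pos t)
  linarith [h.ten_mul_α_le_one t]

/-! ### Stages with a small decrease of the potential -/

theorem drop_terms_nonneg (t : ℕ) (s : State N K) :
    0 ≤ 1 / (N * A.α t) / 4 * sqNorm (A.searchDir t s) ∧ 0 ≤ A.a / 2 * consErr s.x ∧
      0 ≤ A.wt t * A.b / 2 * consErr s.y := by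
  have := h.α_pos t
  have := h.a_pos
  have := h.b_pos
  have := h.wt_pos t
  have := sqNorm_nonneg (A.searchDir t s)
  have := consErr_nonneg s.x
  have := consErr_nonneg s.y
  refine ⟨?_, ?_, ?_⟩ <;> positivity

theorem drop_nonneg (t : ℕ) (s : State N K) : 0 ≤ A.drop t s := by
  obtain ⟨hdir, hx, hy⟩ := h.drop_terms_nonneg t s
  exact add_nonneg (add_nonneg hdir hx) hy

theorem stageDrop_nonneg (t : ℕ) : 0 ≤ A.stageDrop t :=
  Finset.sum_nonneg fun _ _ => h.drop_nonneg t _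

theorem drop_le_stageDrop {t r : ℕ} (hr : r < A.R t) :
    A.drop t (A.iter t r) ≤ A.stageDrop t :=
  Finset.single_le_sum (f := fun k => A.drop t (A.iter t k)) (fun _ _ => h.drop_nonneg t _)
    (Finset.mem_range.2 hr)

theorem sqNorm_searchDir_le_drop (t : ℕ) (s : State N K) :
    sqNorm (A.searchDir t s) ≤ 4 * (N * A.α t) * A.drop t s := by
  have hα := h.α_pos t
  have hN : (0 : ℝ) < N := Nat.cast_pos.2 (NeZero.pos N)
  obtain ⟨-, hx, hy⟩ := h.drop_terms_nonneg t s
  have hle : 1 / (N * A.α t) / 4 * sqNorm (A.searchDir t s) ≤ A.drop t s := by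
    unfold drop
    linarith
  rw [div_div, one_div_mul_eq_div, div_le_iff₀ (by positivity)] at hle
  linarith

theorem consErr_x_le_drop (t : ℕ) (s : State N K) : consErr s.x ≤ 2 / A.a * A.drop t s := by
  obtain ⟨hdir, -, hy⟩ := h.drop_terms_nonneg t s
  have hle : A.a / 2 * consErr s.x ≤ A.drop t s := by
    unfold drop
    linarith
  rw [div_mul_eq_mul_div, le_div_iff₀ h.a_pos]
  linarith

theorem consErr_y_le_drop (t : ℕ) (s : State N K) :
    consErr s.y ≤ N / A.α t * A.drop t s := by
  obtain ⟨hdir, hx, -⟩ := h.drop_terms_nonneg t s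
  have hle : A.wt t * A.b / 2 * consErr s.y ≤ A.drop t s := by
    unfold drop
    linarith
  rw [div_mul_eq_mul_div, le_div_iff₀ (h.α_pos t)]
  calc consErr s.y * A.α t ≤ consErr s.y * (N * A.wt t * A.b / 2) := by
        have := h.two_mul_α_le t
        have := consErr_nonneg s.y
        gcongr
        linarith
    _ = N * (A.wt t * A.b / 2 * consErr s.y) := by ring
    _ ≤ N * A.drop t s := by gcongr

theorem norm_mean_next_sub_sq_le (t : ℕ) (s : State N K) :
    ‖mean (A.next t s).x - mean s.x‖ ^ 2 ≤ A.α t * A.drop t s := by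
  have hN : (0 : ℝ) < N := Nat.cast_pos.2 (NeZero.pos N)
  have hdir := (norm_mean_sq_le (A.searchDir t s)).trans (h.sqNorm_searchDir_le_drop t s)
  have hmean : ‖mean (A.next t s).x - mean s.x‖ ^ 2
      = 1 / 4 * ‖mean (A.searchDir t s)‖ ^ 2 := by
    rw [next, mean_innerStep_x h.mixing, add_sub_cancel_left, norm_smul, mul_pow, searchDir]
    norm_num
  rw [hmean]
  refine le_of_mul_le_mul_left ?_ hN
  linarith

theorem norm_mean_iter_sub_sq_le {t r : ℕ} (hr : r ≤ A.R t) :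
    ‖mean (A.iter t r).x - mean (A.state t).x‖ ^ 2 ≤ A.R t * A.α t * A.stageDrop t := by
  have hα := h.α_pos t
  have hpath : ‖mean (A.iter t r).x - mean (A.state t).x‖
      ≤ ∑ k ∈ Finset.range r, ‖mean (A.iter t (k + 1)).x - mean (A.iter t k).x‖ := by
    have := dist_le_range_sum_dist (fun k => mean (A.iter t k).x) r
    simpa only [dist_eq_norm', iter_zero] using this
  calc ‖mean (A.iter t r).x - mean (A.state t).x‖ ^ 2
      ≤ r * ∑ k ∈ Finset.range r, ‖mean (A.iter t (k + 1)).x - mean (A.iter t k).x‖ ^ 2 := by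
        refine (pow_le_pow_left₀ (norm_nonneg _) hpath 2).trans ?_
        simpa only [Finset.card_range] using sq_sum_le_card_mul_sum_sq (s := Finset.range r)
          (f := fun k => ‖mean (A.iter t (k + 1)).x - mean (A.iter t k).x‖)
    _ ≤ r * ∑ k ∈ Finset.range r, A.α t * A.drop t (A.iter t k) := by
        gcongr with k
        rw [iter_succ]
        exact h.norm_mean_next_sub_sq_le t _
    _ ≤ A.R t * (A.α t * A.stageDrop t) := by
        have hsub : ∑ k ∈ Finset.range r, A.drop t (A.iter t k) ≤ A.stageDrop t :=
          Finset.sum_le_sum_of_subset_of_nonneg (Finset.range_mono hr)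
            fun _ _ _ => h.drop_nonneg t _
        have hnonneg : 0 ≤ ∑ k ∈ Finset.range r, A.drop t (A.iter t k) :=
          Finset.sum_nonneg fun _ _ => h.drop_nonneg t _
        rw [← Finset.mul_sum]
        gcongr
    _ = _ := by ring

section SmallDrop

variable {t r : ℕ} (hD : A.stageDrop t ≤ A.acc * d ^ 2 / 128)

include hD

theorem norm_searchDir_le (hr : r < A.R t) (i : Fin N) :
    ‖A.searchDir t (A.iter t r) i‖ ≤ d / 10 := by
  have hd := h.d_pos
  have hacc := mul_le_mul_of_nonneg_right h.acc_le_two (sq_nonneg d)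
  have hstep := mul_le_mul_of_nonneg_right (h.ten_mul_le_one t) (h.drop_nonneg t (A.iter t r))
  refine le_of_sq_le_sq ((norm_sq_le_sqNorm _ i).trans ?_) (by positivity)
  linarith [h.sqNorm_searchDir_le_drop t (A.iter t r), h.drop_le_stageDrop hr, sq_nonneg d]

theorem norm_iter_x_sub_mean_le (hr : r < A.R t) (i : Fin N) :
    ‖(A.iter t r).x i - mean (A.iter t r).x‖ ≤ d / 5 := by
  have hd := h.d_pos
  have ha := h.a_pos
  refine le_of_sq_le_sq ((norm_sub_mean_sq_le_consErr _ i).trans ?_) (by positivity)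
  calc consErr (A.iter t r).x ≤ 2 / A.a * A.drop t (A.iter t r) := h.consErr_x_le_drop t _
    _ ≤ 2 / A.a * (2 * A.a * d ^ 2 / 128) := by
        have := (h.drop_le_stageDrop hr).trans hD
        have := mul_le_mul_of_nonneg_right h.acc_lt.le (sq_nonneg d)
        gcongr
        linarith
    _ = d ^ 2 / 32 := by field_simp; norm_num
    _ ≤ (d / 5) ^ 2 := by linarith [sq_nonneg d]

theorem norm_mean_iter_sub_le (hr : r ≤ A.R t) :
    ‖mean (A.iter t r).x - mean (A.state t).x‖ ≤ d / 10 := by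
  have hd := h.d_pos
  have hα := h.α_pos t
  refine le_of_sq_le_sq ((h.norm_mean_iter_sub_sq_le hr).trans ?_) (by positivity)
  calc A.R t * A.α t * A.stageDrop t ≤ A.R t * A.α t * (A.acc * d ^ 2 / 128) := by gcongr
    _ = A.R t * (A.acc * A.α t) * (d ^ 2 / 128) := by ring
    _ ≤ 6 / 5 * (d ^ 2 / 128) := by gcongr; exact h.R_mul_le t
    _ ≤ (d / 10) ^ 2 := by linarith [sq_nonneg d]

end SmallDrop

/-! ### Stage zero -/

theorem mean_iter_stage_zero (r : ℕ) : mean (A.iter 0 r).x = mean A.x0 := by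
  induction r with
  | zero => rfl
  | succ r ih =>
    have hdir : mean (A.searchDir 0 (A.iter 0 r)) = 0 := by
      rw [h.searchDir_stage_zero, mean_sub, mean_const, ih, sub_self]
    rw [iter_succ, next, mean_innerStep_x h.mixing]
    exact (congrArg _ (congrArg _ hdir)).trans (by rw [smul_zero, add_zero, ih])

theorem mean_state_succ_mem (t : ℕ) : mean (A.state (t + 1)).x ∈ A.X t := by
  cases t with
  | zero =>
    rw [← iter_R, h.mean_iter_stage_zero]
    exact h.mean_x0_mem_X 0
  | succ t =>
    rw [← iter_R]
    exact mean_mem (A.convex_X (t + 1)) (h.iter_succ_x_mem t (A.R (t + 1)))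

theorem consErr_next_stage_zero_x_le (s : State N K) :
    consErr (A.next 0 s).x ≤ 1 / 4 * consErr s.x := by
  have hx : (A.next 0 s).x
      = mix A.W fun i => (1 / 2 : ℝ) • s.x i - (-(1 / 2 : ℝ)) • mean A.x0 := by
    have hdir : dir (A.X 0) (A.α 0) s = _ := h.searchDir_stage_zero s
    rw [next, innerStep_x, hdir]
    congr 1
    funext i
    module
  rw [hx]
  calc _ ≤ eta A.W ^ 2 * (1 / 4 * consErr s.x) := by
        refine (consErr_mix_le h.mixing _).trans_eq ?_
        rw [consErr_sub_const, consErr_smul]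
        norm_num
    _ ≤ 1 / 4 * consErr s.x :=
        mul_le_of_le_one_left (mul_nonneg (by norm_num) (consErr_nonneg _)) h.eta_sq_le_one

theorem wt_mul_consErr_next_stage_zero_y_le {s : State N K} (hs : ∀ i, s.x i ∈ A.X 1)
    (hmean : mean s.x = mean A.x0) :
    A.wt 1 * consErr (A.next 0 s).y ≤ A.wt 1 * consErr s.y + 17 / 64 * consErr s.x := by
  have hwt := h.wt_pos 1
  have hξ := h.ξ_pos
  have hb : (1 + A.ξ) * eta A.W ^ 2 ≤ 1 := sub_nonneg.1 h.b_pos.le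
  have hmove : sqNorm (fun i => (A.next 0 s).x i - s.x i) ≤ 17 / 2 * consErr s.x := by
    refine (sqNorm_innerStep_x_sub_le h.mixing (A.X 0) (A.α 0) (1 / 2) s).trans_eq ?_
    have hdir : dir (A.X 0) (A.α 0) s = _ := h.searchDir_stage_zero s
    have hsq : sqNorm (fun i => mean A.x0 - s.x i) = consErr s.x := by
      simp only [consErr, hmean, sqNorm, norm_sub_rev]
    rw [hdir, hsq]
    ring
  calc A.wt 1 * consErr (A.next 0 s).y
      ≤ A.wt 1 * (1 * consErr s.y
        + (1 + 1 / A.ξ) * A.Lh 1 ^ 2 * (17 / 2 * consErr s.x)) := by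
        gcongr
        refine (consErr_innerStep_y_le h.mixing h.problem (A.isCompact_X 1) hξ hs
          (h.next_x_mem (A.convex_X 1) (h.X_mono zero_le_one) hs)).trans ?_
        exact add_le_add (mul_le_mul_of_nonneg_right hb (consErr_nonneg s.y))
          (mul_le_mul_of_nonneg_left hmove (by positivity))
    _ = A.wt 1 * consErr s.y
        + A.wt 1 * ((1 + 1 / A.ξ) * A.Lh 1 ^ 2) * (17 / 2 * consErr s.x) := by ring
    _ ≤ _ := by
        rw [h.wt_mul]
        linarith [mul_le_mul_of_nonneg_right h.a_le_one (consErr_nonneg s.x)]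

theorem consErr_iter_stage_zero_le (r : ℕ) :
    consErr (A.iter 0 r).x + A.wt 1 * consErr (A.iter 0 r).y
      ≤ consErr A.x0 + A.wt 1 * consErr fun i => ∇ (A.f i) (A.x0 i) := by
  induction r with
  | zero => exact le_rfl
  | succ r ih =>
    have hmem := h.iter_x_mem (A.convex_X 1) (h.X_mono zero_le_one) h.state_zero_x_mem r
    rw [iter_succ]
    linarith [h.consErr_next_stage_zero_x_le (A.iter 0 r), consErr_nonneg (A.iter 0 r).x,
      h.wt_mul_consErr_next_stage_zero_y_le hmem (h.mean_iter_stage_zero r)]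

theorem wt_le_one (t : ℕ) : A.wt t ≤ 1 := by
  have := h.ξ_pos
  have := h.one_le_Lh t
  have hden : 1 ≤ (1 + 1 / A.ξ) * A.Lh t ^ 2 :=
    one_le_mul_of_one_le_of_one_le (le_add_of_nonneg_right (by positivity))
      (one_le_pow₀ (h.one_le_Lh t))
  rw [wt, div_le_one (by positivity)]
  linarith [h.a_le_one]

theorem P_state_one_le :
    A.P (A.state 1) 1 ≤ avgFun A.f (mean A.x0) + consErr A.x0
      + consErr fun i => ∇ (A.f i) (A.x0 i) := by
  have hy := mul_le_mul_of_nonneg_right (h.wt_le_one 1)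
    (consErr_nonneg fun i => ∇ (A.f i) (A.x0 i))
  rw [P_eq, ← iter_R, h.mean_iter_stage_zero]
  linarith [h.consErr_iter_stage_zero_le (A.R 0)]

/-! ### The averaged gap -/

section AveragedGap

variable {t r : ℕ}

theorem localArgmin_mem_interior (hD : A.stageDrop (t + 1) ≤ A.acc * d ^ 2 / 128)
    (hr : r < A.R (t + 1)) (i : Fin N) :
    localArgmin (A.X (t + 1)) (A.α (t + 1)) ((A.iter (t + 1) r).x i) ((A.iter (t + 1) r).y i)
      ∈ interior (A.X (t + 1)) := by
  set s := A.iter (t + 1) r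
  set p := localArgmin (A.X (t + 1)) (A.α (t + 1)) (s.x i) (s.y i)
  have hstep : ‖p - s.x i‖ ≤ d / 10 := h.norm_searchDir_le hD hr i
  have hconsensus : ‖s.x i - mean s.x‖ ≤ d / 5 := h.norm_iter_x_sub_mean_le hD hr i
  have hdrift : ‖mean s.x - mean (A.state (t + 1)).x‖ ≤ d / 10 :=
    h.norm_mean_iter_sub_le hD hr.le
  have hstart : ‖mean (A.state (t + 1)).x - mean A.x0‖ ≤ t * d := by
    simpa only [X, h.v_eq, mem_closedBall_iff_norm] using h.mean_state_succ_mem t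
  refine Metric.ball_subset_interior_closedBall ?_
  rw [mem_ball_iff_norm, h.v_eq]
  push_cast
  linarith [h.d_pos, norm_sub_le_norm_sub_add_norm_sub p (s.x i) (mean A.x0),
    norm_sub_le_norm_sub_add_norm_sub (s.x i) (mean s.x) (mean A.x0),
    norm_sub_le_norm_sub_add_norm_sub (mean s.x) (mean (A.state (t + 1)).x) (mean A.x0)]

theorem searchDir_eq_of_stageDrop_le (hD : A.stageDrop (t + 1) ≤ A.acc * d ^ 2 / 128)
    (hr : r < A.R (t + 1)) :
    A.searchDir (t + 1) (A.iter (t + 1) r)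
      = fun i => -A.α (t + 1) • (A.iter (t + 1) r).y i := by
  funext i
  rw [neg_smul]
  exact sub_eq_neg_smul_of_isMinOn_of_mem_interior (A.convex_X _) (h.α_pos _)
    (h.localArgmin_mem_interior hD hr i)
    (localArgmin_spec (A.isCompact_X _) ⟨_, h.mean_x0_mem_X _⟩ _ _ _).2

theorem gap_le_drop {s : State N K} (hs : A.searchDir t s = fun i => -A.α t • s.y i) :
    sqNorm s.y + consErr s.x + consErr s.y ≤ gapConst N A.a / A.α t * A.drop t s := by
  have hα := h.α_pos t
  have ha := h.a_pos
  have hdrop := h.drop_nonneg t s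
  have hy : sqNorm s.y ≤ 4 * N / A.α t * A.drop t s := by
    have hdir := h.sqNorm_searchDir_le_drop t s
    rw [hs, sqNorm_smul] at hdir
    rw [div_mul_eq_mul_div, le_div_iff₀ hα]
    refine le_of_mul_le_mul_left ?_ hα
    linarith
  have hx : consErr s.x ≤ 2 / A.a / A.α t * A.drop t s := by
    refine (h.consErr_x_le_drop t s).trans ?_
    gcongr ?_ * _
    exact le_div_self (by positivity) hα (min_le_right _ _)
  calc sqNorm s.y + consErr s.x + consErr s.y
      ≤ 4 * N / A.α t * A.drop t s + 2 / A.a / A.α t * A.drop t s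
        + N / A.α t * A.drop t s := by gcongr; exact h.consErr_y_le_drop t s
    _ = gapConst N A.a / A.α t * A.drop t s := by unfold gapConst; ring

theorem avgGap_le_of_stageDrop_le (hD : A.stageDrop (t + 1) ≤ A.acc * d ^ 2 / 128) :
    A.avgGap (t + 1) ≤ gapConst N A.a * A.stageDrop (t + 1) * A.acc := by
  have hα := h.α_pos (t + 1)
  have hR : (0 : ℝ) < A.R (t + 1) := Nat.cast_pos.2 (h.R_pos (t + 1))
  have hg := gapConst_pos (N := N) h.a_pos
  have hdrop := h.stageDrop_nonneg (t + 1)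
  rw [avgGap, one_div_mul_eq_div, div_le_iff₀ hR]
  calc _ ≤ ∑ r ∈ Finset.range (A.R (t + 1)),
          gapConst N A.a / A.α (t + 1) * A.drop (t + 1) (A.iter (t + 1) r) :=
        Finset.sum_le_sum fun r hr => h.gap_le_drop
          (h.searchDir_eq_of_stageDrop_le hD (Finset.mem_range.1 hr))
    _ = gapConst N A.a / A.α (t + 1) * A.stageDrop (t + 1) * 1 := by
        rw [← Finset.mul_sum, mul_one, stageDrop]
    _ ≤ gapConst N A.a / A.α (t + 1) * A.stageDrop (t + 1)
        * (A.R (t + 1) * (A.acc * A.α (t + 1))) := by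
        gcongr
        exact h.one_le_R_mul (t + 1)
    _ = _ := by field_simp

theorem exists_avgGap_le {T : ℕ} (hT : 0 < T)
    (hT' : 128 * (A.P (A.state 1) 1 - flow) ≤ T * (A.acc * d ^ 2)) :
    ∃ t, 1 ≤ t ∧ t ≤ T ∧
      A.avgGap t ≤ gapConst N A.a * (A.P (A.state 1) 1 - flow) * A.acc := by
  obtain ⟨t, htT, ht⟩ := h.exists_stageDrop_le hT
  have hT1 : (1 : ℝ) ≤ T := Nat.one_le_cast.2 hT
  have hD : A.stageDrop (t + 1) ≤ A.acc * d ^ 2 / 128 := by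
    refine le_of_mul_le_mul_left ?_ (one_pos.trans_le hT1)
    linarith
  have hle : A.stageDrop (t + 1) ≤ A.P (A.state 1) 1 - flow :=
    (le_mul_of_one_le_left (h.stageDrop_nonneg _) hT1).trans ht
  refine ⟨t + 1, t.succ_pos, htT, (h.avgGap_le_of_stageDrop_le hD).trans ?_⟩
  have := gapConst_pos (N := N) h.a_pos
  have := h.acc_pos
  gcongr

end AveragedGap

end Input.StandingAssumption

/-- The factor in the bound of the reciprocal stepsize by the squared Lipschitz constant; the three
summands account for the three terms of the minimum that defines the stepsize. -/
def stepConst (N : ℕ) (γ ξ a b : ℝ) : ℝ :=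
  8 * N * (1 / (2 * N) + (1 / γ + 5 / 4)) + 64 * (1 + 1 / ξ) / (N * a * b) + 1

/-- The factor in the bounds of both the averaged gap and the cost of a run. -/
def rateConst (N : ℕ) (η γ ξ : ℝ) : ℝ :=
  gapConst N (1 - (1 + γ) * η ^ 2)
    + 5 * stepConst N γ ξ (1 - (1 + γ) * η ^ 2) (1 - (1 + ξ) * η ^ 2) + 2

theorem stepConst_pos {N : ℕ} {γ ξ a b : ℝ} (hγ : 0 < γ) (hξ : 0 < ξ) (ha : 0 < a) (hb : 0 < b) :
    0 < stepConst N γ ξ a b := by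
  unfold stepConst
  positivity

section RateConst

variable {N : ℕ} {η γ ξ : ℝ} (hγ : 0 < γ) (hξ : 0 < ξ) (hγη : (1 + γ) * η ^ 2 < 1)
  (hξη : (1 + ξ) * η ^ 2 < 1)

include hγ hξ hγη hξη

theorem gapConst_le_rateConst : gapConst N (1 - (1 + γ) * η ^ 2) ≤ rateConst N η γ ξ := by
  have := stepConst_pos (N := N) hγ hξ (sub_pos.2 hγη) (sub_pos.2 hξη)
  unfold rateConst
  linarith

theorem rateConst_pos [NeZero N] : 0 < rateConst N η γ ξ :=
  (gapConst_pos (sub_pos.2 hγη)).trans_le (gapConst_le_rateConst hγ hξ hγη hξη)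

end RateConst

namespace Input

variable {N K : ℕ} (A : Input N K)

theorem comm_iter (t r : ℕ) : (A.iter t r).comm = (A.state t).comm + r := by
  induction r with
  | zero => rfl
  | succ r ih => rw [iter_succ, ← add_assoc, ← ih]; rfl

theorem grads_iter (t r : ℕ) : (A.iter t r).grads = (A.state t).grads + 2 * r := by
  induction r with
  | zero => rfl
  | succ r ih => rw [iter_succ, mul_add_one, ← add_assoc, ← ih]; rfl

theorem comm_state (t : ℕ) : (A.state t).comm = ∑ k ∈ Finset.range t, A.R k := by
  induction t with
  | zero => rfl
  | succ t ih => rw [← iter_R, comm_iter, ih, Finset.sum_range_succ]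

theorem grads_state (t : ℕ) : (A.state t).grads = 1 + 2 * ∑ k ∈ Finset.range t, A.R k := by
  induction t with
  | zero => rfl
  | succ t ih => rw [← iter_R, grads_iter, ih, Finset.sum_range_succ, mul_add, add_assoc]

end Input

namespace Input.StandingAssumption

variable {N K : ℕ} {A : Input N K} {L : Set (Vec K) → ℝ} {flow d : ℝ}
  (h : A.StandingAssumption L flow d) [NeZero N]

include h

theorem one_le_stepConst_mul (t : ℕ) :
    1 ≤ stepConst N A.γ A.ξ A.a A.b * A.Lh t ^ 2 * A.α t := by
  have hγ := h.γ_pos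
  have hξ := h.ξ_pos
  have ha := h.a_pos
  have hb := h.b_pos
  have hN : (0 : ℝ) < N := Nat.cast_pos.2 (NeZero.pos N)
  have hC := stepConst_pos (N := N) hγ hξ ha hb
  have hC₁ : 0 ≤ 8 * N * (1 / (2 * N) + (1 / A.γ + 5 / 4)) := by positivity
  have hC₂ : 0 ≤ 64 * (1 + 1 / A.ξ) / (N * A.a * A.b) := by positivity
  have hℓ := h.one_le_Lh t
  have hℓ2 : A.Lh t ≤ A.Lh t ^ 2 := le_self_pow₀ hℓ two_ne_zero
  have hℓ1 : 1 ≤ A.Lh t ^ 2 := one_le_pow₀ hℓ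
  rw [← div_le_iff₀' (by positivity)]
  refine le_min (le_min ?_ ?_) ?_
  · rw [one_div_mul_one_div]
    refine one_div_le_one_div_of_le (by positivity) ?_
    calc 8 * N * (A.Lh t / (2 * N) + (1 / A.γ + 5 / 4))
        ≤ 8 * N * (A.Lh t / (2 * N) + A.Lh t * (1 / A.γ + 5 / 4)) := by
          gcongr
          exact le_mul_of_one_le_left (by positivity) hℓ
      _ = 8 * N * (1 / (2 * N) + (1 / A.γ + 5 / 4)) * A.Lh t := by ring
      _ ≤ stepConst N A.γ A.ξ A.a A.b * A.Lh t ^ 2 := by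
          gcongr
          unfold stepConst
          linarith
  · rw [one_div_le (by positivity) (by positivity), one_div_div]
    calc 64 * (1 + 1 / A.ξ) * A.Lh t ^ 2 / (N * A.a * A.b)
        = 64 * (1 + 1 / A.ξ) / (N * A.a * A.b) * A.Lh t ^ 2 := by ring
      _ ≤ stepConst N A.γ A.ξ A.a A.b * A.Lh t ^ 2 := by
          gcongr
          unfold stepConst
          linarith
  · refine (div_le_one (by positivity)).2 (one_le_mul_of_one_le_of_one_le ?_ hℓ1)
    unfold stepConst
    linarith

theorem R_le {t T : ℕ} (htT : t ≤ T) :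
    A.R t ≤ 6 / 5 * stepConst N A.γ A.ξ A.a A.b * A.Lh T ^ 2 * (1 / A.acc) := by
  have hα := h.α_pos t
  have hC := stepConst_pos (N := N) h.γ_pos h.ξ_pos h.a_pos h.b_pos
  have hℓ := h.one_le_Lh t
  rw [mul_one_div, le_div_iff₀ h.acc_pos]
  refine le_of_mul_le_mul_right ?_ hα
  calc A.R t * A.acc * A.α t ≤ 6 / 5 * 1 := by linarith [h.R_mul_le t]
    _ ≤ 6 / 5 * (stepConst N A.γ A.ξ A.a A.b * A.Lh t ^ 2 * A.α t) := by
        gcongr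
        exact h.one_le_stepConst_mul t
    _ ≤ 6 / 5 * (stepConst N A.γ A.ξ A.a A.b * A.Lh T ^ 2 * A.α t) := by
        gcongr
        exact h.Lh_mono htT
    _ = _ := by ring

theorem sum_R_le {T : ℕ} (hT : 0 < T) :
    ∑ k ∈ Finset.range (T + 1), (A.R k : ℝ)
      ≤ 12 / 5 * stepConst N A.γ A.ξ A.a A.b * (T * (1 / A.acc) * A.Lh T ^ 2) := by
  have hacc := h.acc_pos
  have hC := stepConst_pos (N := N) h.γ_pos h.ξ_pos h.a_pos h.b_pos
  have hT1 : (1 : ℝ) ≤ T := Nat.one_le_cast.2 hT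
  calc _ ≤ (T + 1 : ℕ) • (6 / 5 * stepConst N A.γ A.ξ A.a A.b * A.Lh T ^ 2 * (1 / A.acc)) := by
        simpa only [Finset.card_range] using Finset.sum_le_card_nsmul _ _ _
          fun k hk => h.R_le (Finset.mem_range_succ_iff.1 hk)
    _ ≤ 2 * T * (6 / 5 * stepConst N A.γ A.ξ A.a A.b * A.Lh T ^ 2 * (1 / A.acc)) := by
        rw [nsmul_eq_mul]
        gcongr
        push_cast
        linarith
    _ = _ := by ring

theorem grads_state_le {T : ℕ} (hT : 0 < T) :
    ((A.state (T + 1)).grads : ℝ)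
      ≤ rateConst N (eta A.W) A.γ A.ξ * (T * (1 / A.acc) * A.Lh T ^ 2) := by
  have hacc := h.acc_pos
  have hC := stepConst_pos (N := N) h.γ_pos h.ξ_pos h.a_pos h.b_pos
  have hB : 1 / 2 ≤ T * (1 / A.acc) * A.Lh T ^ 2 := by
    calc (1 : ℝ) / 2 = 1 * (1 / 2) * 1 := by ring
      _ ≤ _ := by
        gcongr
        · exact Nat.one_le_cast.2 hT
        · exact h.acc_le_two
        · exact one_le_pow₀ (h.one_le_Lh T)
  have hg := mul_nonneg (gapConst_pos (N := N) h.a_pos).le (one_half_pos.le.trans hB)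
  have hs := mul_nonneg hC.le (one_half_pos.le.trans hB)
  rw [Input.grads_state]
  change _ ≤ (gapConst N A.a + 5 * stepConst N A.γ A.ξ A.a A.b + 2) * _
  push_cast
  linarith [h.sum_R_le hT]

theorem comm_state_le {T : ℕ} (hT : 0 < T) :
    ((A.state (T + 1)).comm : ℝ)
      ≤ rateConst N (eta A.W) A.γ A.ξ * (T * (1 / A.acc) * A.Lh T ^ 2) := by
  refine le_trans (Nat.cast_le.2 ?_) (h.grads_state_le hT)
  rw [Input.comm_state, Input.grads_state]
  lia

end Input.StandingAssumption

section Polynomials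

open MvPolynomial

/-- The sum of the absolute values of the coefficients of a polynomial, which bounds its growth. -/
def coeffNorm {σ : Type*} (p : MvPolynomial σ ℝ) : ℝ := ∑ s ∈ p.support, |p.coeff s|

/-- The sum of the coefficient norms of the second partial derivatives of a polynomial, which bounds
the growth of the Lipschitz constants of its gradient. -/
def hessianNorm {σ : Type*} [Fintype σ] (p : MvPolynomial σ ℝ) : ℝ :=
  ∑ j, ∑ i, coeffNorm (pderiv i (pderiv j p))

theorem coeffNorm_nonneg {σ : Type*} (p : MvPolynomial σ ℝ) : 0 ≤ coeffNorm p :=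
  Finset.sum_nonneg fun _ _ => abs_nonneg _

theorem hessianNorm_nonneg {σ : Type*} [Fintype σ] (p : MvPolynomial σ ℝ) : 0 ≤ hessianNorm p :=
  Finset.sum_nonneg fun _ _ => Finset.sum_nonneg fun _ _ => coeffNorm_nonneg _

theorem abs_eval_le {σ : Type*} {p : MvPolynomial σ ℝ} {n : ℕ} (hp : p.totalDegree ≤ n)
    {u : σ → ℝ} {ρ : ℝ} (hρ : 1 ≤ ρ) (hu : ∀ k, |u k| ≤ ρ) :
    |eval u p| ≤ coeffNorm p * ρ ^ n := by
  rw [eval_eq, coeffNorm, Finset.sum_mul]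
  refine (Finset.abs_sum_le_sum_abs _ _).trans (Finset.sum_le_sum fun s hs => ?_)
  rw [abs_mul, Finset.abs_prod]
  gcongr
  calc ∏ k ∈ s.support, |u k ^ s k| ≤ ∏ k ∈ s.support, ρ ^ s k := by
        gcongr with k
        rw [abs_pow]
        gcongr
        exact hu k
    _ = ρ ^ s.sum fun _ e => e := Finset.prod_pow_eq_pow_sum _ _ _
    _ ≤ ρ ^ n := pow_le_pow_right₀ hρ ((le_totalDegree hs).trans hp)

theorem totalDegree_pderiv_le {σ R : Type*} [CommSemiring R] {p : MvPolynomial σ R} {m : ℕ}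
    (hp : p.totalDegree ≤ m + 1) (j : σ) : (pderiv j p).totalDegree ≤ m := by
  rw [p.as_sum, map_sum]
  refine totalDegree_finsetSum_le fun s hs => ?_
  rw [pderiv_monomial]
  by_cases hj : s j = 0
  · rw [hj, Nat.cast_zero, mul_zero, monomial_zero, totalDegree_zero]
    exact m.zero_le
  · have hsub : s - Finsupp.single j 1 + Finsupp.single j 1 = s :=
      tsub_add_cancel_of_le (Finsupp.single_le_iff.2 (Nat.one_le_iff_ne_zero.2 hj))
    have hdeg : s.degree = (s - Finsupp.single j 1).degree + 1 := by
      conv_lhs => rw [← hsub, map_add, Finsupp.degree_single]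
    have hs : s.degree ≤ m + 1 := (le_totalDegree hs).trans hp
    exact (totalDegree_monomial_le _ _).trans (by change Finsupp.degree _ ≤ m; lia)

variable {σ : Type*} [Fintype σ]

theorem hasFDerivAt_eval (p : MvPolynomial σ ℝ) (u : EuclideanSpace ℝ σ) :
    HasFDerivAt (fun u : EuclideanSpace ℝ σ => eval (fun k => u k) p)
      (∑ j, eval (fun k => u k) (pderiv j p) • (EuclideanSpace.proj j : _ →L[ℝ] ℝ)) u := by
  classical
  induction p using MvPolynomial.induction_on with
  | C a =>
    simp only [eval_C, pderiv_C, map_zero, zero_smul, Finset.sum_const_zero]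
    exact hasFDerivAt_const a u
  | add p q hp hq =>
    simp only [map_add, add_smul, Finset.sum_add_distrib]
    exact hp.add hq
  | mul_X p i hp =>
    have hX : HasFDerivAt (fun u : EuclideanSpace ℝ σ => u i)
        (EuclideanSpace.proj i : _ →L[ℝ] ℝ) u :=
      (EuclideanSpace.proj i : EuclideanSpace ℝ σ →L[ℝ] ℝ).hasFDerivAt
    simp only [eval_mul, eval_X]
    refine (hp.mul hX).congr_fderiv ?_
    ext w
    simp [pderiv_X, Pi.single_apply, apply_ite (eval fun k => u k), mul_add,
      Finset.sum_add_distrib, Finset.mul_sum, mul_comm, mul_left_comm]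

theorem gradient_eval (p : MvPolynomial σ ℝ) (u : EuclideanSpace ℝ σ) :
    ∇ (fun u : EuclideanSpace ℝ σ => eval (fun k => u k) p) u
      = WithLp.toLp 2 fun j => eval (fun k => u k) (pderiv j p) := by
  refine HasGradientAt.gradient ((hasFDerivAt_eval p u).congr_fderiv ?_)
  ext w
  simp [PiLp.inner_apply, mul_comm]

theorem abs_eval_sub_eval_le {p : MvPolynomial σ ℝ} {m : ℕ} (hp : p.totalDegree ≤ m + 1)
    {ρ : ℝ} (hρ : 1 ≤ ρ) {u w : EuclideanSpace ℝ σ} (hu : ‖u‖ ≤ ρ) (hw : ‖w‖ ≤ ρ) :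
    |eval (fun k => u k) p - eval (fun k => w k) p|
      ≤ (∑ j, coeffNorm (pderiv j p)) * ρ ^ m * ‖u - w‖ := by
  refine (convex_closedBall (0 : EuclideanSpace ℝ σ) ρ).norm_image_sub_le_of_norm_hasFDerivWithin_le
    (fun v _ => (hasFDerivAt_eval p v).hasFDerivWithinAt) (fun v hv => ?_)
    (mem_closedBall_zero_iff.2 hw) (mem_closedBall_zero_iff.2 hu)
  rw [Finset.sum_mul]
  refine norm_sum_le_of_le _ fun j _ => ?_
  have hv' (k : σ) : |v k| ≤ ρ := (PiLp.norm_apply_le v k).trans (mem_closedBall_zero_iff.1 hv)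
  have hproj : ‖(EuclideanSpace.proj j : EuclideanSpace ℝ σ →L[ℝ] ℝ)‖ ≤ 1 :=
    ContinuousLinearMap.opNorm_le_bound _ zero_le_one fun v =>
      (PiLp.norm_apply_le v j).trans_eq (one_mul _).symm
  rw [norm_smul]
  exact (mul_le_of_le_one_right (norm_nonneg _) hproj).trans
    (abs_eval_le (totalDegree_pderiv_le hp j) hρ hv')

theorem norm_le_sum_abs (v : EuclideanSpace ℝ σ) : ‖v‖ ≤ ∑ j, |v j| := by
  rw [EuclideanSpace.norm_eq]
  refine (Real.sqrt_le_left (Finset.sum_nonneg fun _ _ => abs_nonneg _)).2 ?_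
  exact Finset.sum_sq_le_sq_sum_of_nonneg fun _ _ => abs_nonneg _

theorem lipOn_gradient_eval {K : ℕ} {p : MvPolynomial (Fin K) ℝ} {m : ℕ}
    (hp : p.totalDegree ≤ m + 2) {ρ : ℝ} (hρ : 1 ≤ ρ) :
    LipOn (∇ fun u : Vec K => eval (fun k => u k) p) (hessianNorm p * ρ ^ m)
      (Metric.closedBall 0 ρ) := by
  intro u hu w hw
  rw [mem_closedBall_zero_iff] at hu hw
  refine (norm_le_sum_abs _).trans ?_
  rw [hessianNorm, Finset.sum_mul, Finset.sum_mul]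
  refine Finset.sum_le_sum fun j _ => ?_
  rw [PiLp.sub_apply, gradient_eval, gradient_eval]
  exact abs_eval_sub_eval_le (totalDegree_pderiv_le hp j) hρ hu hw

end Polynomials

section GrowthFunction

variable {N K : ℕ} {f : Fin N → Vec K → ℝ} {L : Set (Vec K) → ℝ} {Li : Fin N → Set (Vec K) → ℝ}

theorem LipOn.mono {g : Vec K → Vec K} {ℓ ℓ' : ℝ} {X Y : Set (Vec K)} (hg : LipOn g ℓ Y)
    (hℓ : ℓ ≤ ℓ') (hXY : X ⊆ Y) : LipOn g ℓ' X := fun y hy z hz =>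
  (hg y (hXY hy) z (hXY hz)).trans (mul_le_mul_of_nonneg_right hℓ (norm_nonneg _))

theorem Lhat_sq_le_gr (z : Vec K) (v : ℝ) : Lhat Li (Metric.closedBall z v) ^ 2 ≤ gr L Li z v :=
  le_max_right _ _

theorem gr_nonneg (z : Vec K) (v : ℝ) : 0 ≤ gr L Li z v := (sq_nonneg _).trans (Lhat_sq_le_gr z v)

theorem ProblemAssumption.gr_le_Lhat_sq [NeZero N] {flow : ℝ} (h : ProblemAssumption f L Li flow)
    (z : Vec K) (v : ℝ) : gr L Li z v ≤ Lhat Li (Metric.closedBall z v) ^ 2 := by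
  have hX := isCompact_closedBall z v
  exact max_le ((h.L_le_Lhat _ hX).trans (le_self_pow₀ (h.one_le_Lhat hX) two_ne_zero)) le_rfl

theorem SharpConstants.Lhat_closedBall_le [NeZero N] (hsharp : SharpConstants f Li)
    {p : Fin N → MvPolynomial (Fin K) ℝ} {m : ℕ} (hp : ∀ i, (p i).totalDegree ≤ m + 2)
    (hf : ∀ i, f i = fun u => MvPolynomial.eval (fun k => u k) (p i)) {z : Vec K} {v ρ : ℝ}
    (hρ : 1 ≤ ρ) (hv : v + ‖z‖ ≤ ρ) :
    Lhat Li (Metric.closedBall z v) ≤ (1 + ∑ i, hessianNorm (p i)) * ρ ^ m := by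
  have hsum : 0 ≤ ∑ i, hessianNorm (p i) := Finset.sum_nonneg fun i _ => hessianNorm_nonneg _
  refine ciSup_le fun i => hsharp i _ (isCompact_closedBall z v) _ ?_ ?_
  · exact one_le_mul_of_one_le_of_one_le (le_add_of_nonneg_right hsum) (one_le_pow₀ hρ)
  · rw [hf i]
    refine (lipOn_gradient_eval (hp i) hρ).mono ?_
      (Metric.closedBall_subset_closedBall' (by rwa [dist_zero_right]))
    gcongr
    exact (Finset.single_le_sum (fun j _ => hessianNorm_nonneg (p j)) (Finset.mem_univ i)).trans
      (le_add_of_nonneg_left zero_le_one)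

end GrowthFunction

section Stages

variable {M d ε : ℝ}

theorem stages_pos (hM : 0 < M) (hd : 0 < d) (hε : 0 < ε) : 0 < stages M d ε :=
  Nat.ceil_pos.2 (by positivity)

theorem le_stages_mul (hd : 0 < d) (hε : 0 < ε) : M ≤ stages M d ε * (ε * d ^ 2) := by
  rw [← div_le_iff₀ (by positivity)]
  exact Nat.le_ceil _

theorem mul_inv_sqrt_sq (hε : 0 < ε) : ε * (1 / √ε) ^ 2 = 1 := by
  rw [div_pow, Real.sq_sqrt hε.le, one_pow, mul_one_div_cancel hε.ne']

theorem one_le_two_mul_inv_sqrt (hε : 0 < ε) (hε2 : ε ≤ 2) : 1 ≤ 2 * (1 / √ε) := by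
  rw [mul_one_div, le_div_iff₀ (Real.sqrt_pos.2 hε), one_mul]
  exact Real.sqrt_le_left zero_le_two |>.2 (by linarith)

theorem stages_inv_sqrt_le (hM : 0 ≤ M) (hε : 0 < ε) : stages M (1 / √ε) ε ≤ M + 1 := by
  rw [stages, mul_inv_sqrt_sq hε, div_one]
  exact (Nat.ceil_lt_add_one hM).le

end Stages

theorem Input.ReachesWithin.mono {N K : ℕ} {A : Input N K} {T : ℕ} {tol tol' B B' : ℝ}
    (h : A.ReachesWithin T tol B) (htol : tol ≤ tol') (hB : B ≤ B') :
    A.ReachesWithin T tol' B' :=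
  ⟨h.1.imp fun _ ht => ⟨ht.1, ht.2.1, ht.2.2.trans htol⟩, h.2.1.trans hB, h.2.2.trans hB⟩

theorem Input.StandingAssumption.reachesWithin {N K : ℕ} [NeZero N] {A : Input N K}
    {L : Set (Vec K) → ℝ} {flow d : ℝ} (h : A.StandingAssumption L flow d) {T : ℕ} (hT : 0 < T)
    (hT' : 128 * (A.P (A.state 1) 1 - flow) ≤ T * (A.acc * d ^ 2)) :
    A.ReachesWithin T
      (rateConst N (eta A.W) A.γ A.ξ * (A.P (A.state 1) 1 - flow) * A.acc)
      (rateConst N (eta A.W) A.γ A.ξ * (T * (1 / A.acc) * A.Lh T ^ 2)) := by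
  have hacc := h.acc_pos
  have hP := sub_pos.2 (h.flow_lt_P (A.state 1) 1)
  obtain ⟨t, ht1, htT, ht⟩ := h.exists_avgGap_le hT hT'
  refine ⟨⟨t, ht1, htT, ht.trans ?_⟩, h.comm_state_le hT, h.grads_state_le hT⟩
  gcongr
  exact gapConst_le_rateConst h.γ_pos h.ξ_pos (sub_pos.1 h.a_pos) (sub_pos.1 h.b_pos)

namespace Instance

variable {N K : ℕ} {I : Instance N K} {d ε : ℝ}

variable (I) in
/-- A bound of the initial potential gap `Δ` that does not depend on the radii and the accuracy. -/
def gapBound : ℝ :=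
  avgFun I.f (mean I.x0) + consErr I.x0 + consErr (fun i => ∇ (I.f i) (I.x0 i)) - I.flow

variable (I) in
/-- The factor `κ` of the accuracy parameter `κ ε` for which the averaged gap drops below `ε`. -/
def accFactor (γ ξ : ℝ) : ℝ := 1 / (1 + rateConst N (eta I.W) γ ξ * I.gapBound)

variable (I) in
/-- The numerator of the number of stages that suffices for the accuracy parameter `κ ε`. -/
def stageConst (γ ξ : ℝ) : ℝ := 128 * I.gapBound / I.accFactor γ ξ

theorem bound_mul (κ : ℝ) (T : ℕ) : I.bound d (κ * ε) T = 1 / κ * I.bound d ε T := by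
  rw [bound, bound, ← one_div_mul_one_div]
  ring

/-- The assumptions on a problem instance and the parameters `γ`, `ξ` that do not involve the radii
and the accuracy. -/
structure StandingAssumption (I : Instance N K) (γ ξ : ℝ) : Prop where
  γ_pos : 0 < γ
  ξ_pos : 0 < ξ
  γ_eta : (1 + γ) * eta I.W ^ 2 < 1
  ξ_eta : (1 + ξ) * eta I.W ^ 2 < 1
  mixing : I.W ∈ doublyStochastic ℝ (Fin N)
  problem : ProblemAssumption I.f I.L I.Li I.flow

namespace StandingAssumption

variable {γ ξ κ : ℝ} (h : I.StandingAssumption γ ξ)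

include h

theorem gapBound_pos : 0 < I.gapBound := by
  unfold gapBound
  linarith [h.problem.lower (mean I.x0), consErr_nonneg I.x0,
    consErr_nonneg fun i => ∇ (I.f i) (I.x0 i)]

theorem run (hκ : 0 < κ) (hκ1 : κ ≤ 1) (hA : I.Admissible γ d ε) :
    (I.run γ ξ d (κ * ε)).StandingAssumption I.L I.flow d where
  γ_pos := h.γ_pos
  ξ_pos := h.ξ_pos
  a_pos := sub_pos.2 h.γ_eta
  b_pos := sub_pos.2 h.ξ_eta
  mixing := h.mixing
  problem := h.problem
  d_pos := hA.1
  v_eq _ := rfl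
  acc_pos := mul_pos hκ hA.2.1
  acc_lt := (mul_le_of_le_one_left hA.2.1.le hκ1).trans_lt hA.2.2.1
  x0_mem := hA.2.2.2

theorem run_one (hA : I.Admissible γ d ε) :
    (I.run γ ξ d ε).StandingAssumption I.L I.flow d := by
  simpa only [one_mul] using h.run one_pos le_rfl hA

variable [NeZero N]

theorem rateConst_pos : 0 < rateConst N (eta I.W) γ ξ :=
  Magenta.rateConst_pos h.γ_pos h.ξ_pos h.γ_eta h.ξ_eta

theorem accFactor_pos : 0 < I.accFactor γ ξ := by
  have := mul_pos h.rateConst_pos h.gapBound_pos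
  unfold accFactor
  positivity

theorem accFactor_le_one : I.accFactor γ ξ ≤ 1 := by
  have := mul_pos h.rateConst_pos h.gapBound_pos
  rw [accFactor, div_le_one (by positivity)]
  linarith

theorem rateConst_mul_gapBound_mul_accFactor_le :
    rateConst N (eta I.W) γ ξ * I.gapBound * I.accFactor γ ξ ≤ 1 := by
  have := mul_pos h.rateConst_pos h.gapBound_pos
  rw [accFactor, mul_one_div, div_le_one (by positivity)]
  linarith

theorem stageConst_pos : 0 < I.stageConst γ ξ :=
  div_pos (mul_pos (by norm_num) h.gapBound_pos) h.accFactor_pos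

end StandingAssumption

section Run

variable [NeZero N] {γ ξ acc : ℝ} (h : (I.run γ ξ d acc).StandingAssumption I.L I.flow d)

include h

theorem Δ_pos : 0 < I.Δ γ ξ d acc := sub_pos.2 (h.flow_lt_P _ _)

theorem Δ_le_gapBound : I.Δ γ ξ d acc ≤ I.gapBound := sub_le_sub_right h.P_state_one_le _

theorem reachesWithin_run {T : ℕ} (hT : 0 < T) (hT' : 128 * I.Δ γ ξ d acc ≤ T * (acc * d ^ 2)) :
    (I.run γ ξ d acc).ReachesWithin T (rateConst N (eta I.W) γ ξ * I.Δ γ ξ d acc * acc)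
      (rateConst N (eta I.W) γ ξ * I.bound d acc T) := by
  have hacc : 0 < acc := h.acc_pos
  have hC : 0 < rateConst N (eta I.W) γ ξ :=
    rateConst_pos h.γ_pos h.ξ_pos (sub_pos.1 h.a_pos) (sub_pos.1 h.b_pos)
  refine (h.reachesWithin hT hT').mono le_rfl ?_
  refine mul_le_mul_of_nonneg_left (mul_le_mul_of_nonneg_left ?_ (by positivity)) hC.le
  rw [mul_comm d]
  exact Lhat_sq_le_gr _ _

end Run

namespace StandingAssumption

variable [NeZero N] {γ ξ : ℝ} (h : I.StandingAssumption γ ξ)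

include h

theorem reachesWithin (hA : I.Admissible γ d ε) :
    (I.run γ ξ d ε).ReachesWithin (stages (128 * I.Δ γ ξ d ε) d ε)
      (rateConst N (eta I.W) γ ξ * I.Δ γ ξ d ε * ε)
      (rateConst N (eta I.W) γ ξ * I.bound d ε (stages (128 * I.Δ γ ξ d ε) d ε)) :=
  have hrun := h.run_one hA
  reachesWithin_run hrun (stages_pos (mul_pos (by norm_num) (Δ_pos hrun)) hA.1 hA.2.1)
    (le_stages_mul hA.1 hA.2.1)

theorem reachesWithin_accFactor (hA : I.Admissible γ d ε) :
    (I.run γ ξ d (I.accFactor γ ξ * ε)).ReachesWithin (stages (I.stageConst γ ξ) d ε) ε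
      (rateConst N (eta I.W) γ ξ / I.accFactor γ ξ
        * I.bound d ε (stages (I.stageConst γ ξ) d ε)) := by
  have hκ := h.accFactor_pos
  have hC := h.rateConst_pos
  have hε := hA.2.1
  have hrun := h.run hκ h.accFactor_le_one hA
  have hΔ := Δ_le_gapBound hrun
  set κ := I.accFactor γ ξ
  have hT : 128 * I.Δ γ ξ d (κ * ε) ≤ stages (I.stageConst γ ξ) d ε * (κ * ε * d ^ 2) := by
    calc 128 * I.Δ γ ξ d (κ * ε) ≤ I.stageConst γ ξ * κ := by
          rw [stageConst, div_mul_cancel₀ _ hκ.ne']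
          linarith
      _ ≤ stages (I.stageConst γ ξ) d ε * (ε * d ^ 2) * κ := by
          gcongr
          exact le_stages_mul hA.1 hε
      _ = _ := by ring
  refine (reachesWithin_run hrun (stages_pos h.stageConst_pos hA.1 hε) hT).mono ?_ ?_
  · calc _ ≤ rateConst N (eta I.W) γ ξ * I.gapBound * (κ * ε) := by gcongr
      _ = rateConst N (eta I.W) γ ξ * I.gapBound * κ * ε := by ring
      _ ≤ ε := mul_le_of_le_one_left hε.le h.rateConst_mul_gapBound_mul_accFactor_le
  · rw [bound_mul, ← mul_assoc, mul_one_div]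

end StandingAssumption

theorem exists_bound_inv_sqrt_le [NeZero N] (hprob : ProblemAssumption I.f I.L I.Li I.flow) {m : ℕ}
    (hpoly : I.IsPoly (m + 2)) (hsharp : SharpConstants I.f I.Li) {S : ℝ} (hS : 0 < S) :
    ∃ C : ℝ, 0 < C ∧ ∀ ε : ℝ, 0 < ε → ε ≤ 2 → ∀ T : ℕ, T ≤ S →
      I.bound (1 / √ε) ε T ≤ C * (1 / ε ^ (m + 1)) := by
  choose p hp hf using hpoly
  set H := 1 + ∑ i, hessianNorm (p i)
  have hH : 0 < H := add_pos_of_pos_of_nonneg one_pos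
    (Finset.sum_nonneg fun i _ => hessianNorm_nonneg (p i))
  set B := 2 * (‖mean I.x0‖ + 1) + S
  refine ⟨S * (H * B ^ m) ^ 2, by positivity, fun ε hε hε2 T hT => ?_⟩
  set d := 1 / √ε
  have hd2 : d ^ 2 = 1 / ε := eq_one_div_of_mul_eq_one_right (mul_inv_sqrt_sq hε)
  have hd : 1 ≤ 2 * d := one_le_two_mul_inv_sqrt hε hε2
  have hz := mul_le_mul_of_nonneg_right hd (norm_nonneg (mean I.x0))
  have hdT : d * T ≤ d * S := by gcongr
  have hdS : 0 ≤ d * S := by positivity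
  have hgr : gr I.L I.Li (mean I.x0) (d * T) ≤ (H * B ^ m) ^ 2 * (1 / ε ^ m) := by
    calc gr I.L I.Li (mean I.x0) (d * T) ≤ (H * (B * d) ^ m) ^ 2 := by
          refine (hprob.gr_le_Lhat_sq _ _).trans ?_
          have hLhat := hprob.one_le_Lhat (isCompact_closedBall (mean I.x0) (d * T))
          gcongr
          exact hsharp.Lhat_closedBall_le hp (fun i => funext (hf i))
            (by linarith [norm_nonneg (mean I.x0)]) (by linarith)
      _ = (H * B ^ m) ^ 2 * (d ^ 2) ^ m := by rw [mul_pow B d]; ring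
      _ = _ := by rw [hd2, one_div_pow]
  calc I.bound d ε T ≤ S * (1 / ε) * ((H * B ^ m) ^ 2 * (1 / ε ^ m)) :=
        mul_le_mul (by gcongr) hgr (gr_nonneg _ _) (by positivity)
    _ = _ := by rw [pow_succ ε m, ← one_div_mul_one_div]; ring

theorem StandingAssumption.exists_bound_stages_le [NeZero N] {γ ξ : ℝ}
    (h : I.StandingAssumption γ ξ) {m : ℕ} (hpoly : I.IsPoly (m + 2))
    (hsharp : SharpConstants I.f I.Li) :
    ∃ C : ℝ, 0 < C ∧ ∀ d ε : ℝ, d = 1 / √ε → I.Admissible γ d ε →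
      I.bound d ε (stages (128 * I.Δ γ ξ d ε) d ε) ≤ C * (1 / ε ^ (m + 1)) ∧
      I.bound d ε (stages (I.stageConst γ ξ) d ε) ≤ C * (1 / ε ^ (m + 1)) := by
  have hD := h.gapBound_pos
  have hM := h.stageConst_pos
  obtain ⟨C, hC, hbound⟩ := exists_bound_inv_sqrt_le h.problem hpoly hsharp
    (S := 128 * I.gapBound + I.stageConst γ ξ + 1) (by positivity)
  refine ⟨C, hC, ?_⟩
  rintro _ ε rfl hA
  have hε := hA.2.1
  have hrun := h.run_one hA
  have hΔ := Δ_pos hrun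
  refine ⟨hbound ε hε hrun.acc_le_two _ ((stages_inv_sqrt_le (by positivity) hε).trans ?_),
    hbound ε hε hrun.acc_le_two _ ((stages_inv_sqrt_le hM.le hε).trans ?_)⟩
  · linarith [Δ_le_gapBound hrun]
  · linarith

theorem StandingAssumption.exists_rate [NeZero N] {γ ξ : ℝ} (h : I.StandingAssumption γ ξ)
    {m : ℕ} (hpoly : I.IsPoly (m + 2)) (hsharp : SharpConstants I.f I.Li) :
    ∃ C : ℝ, 0 < C ∧ ∀ d ε : ℝ, d = 1 / √ε → I.Admissible γ d ε →
      I.bound d ε (stages (128 * I.Δ γ ξ d ε) d ε) ≤ C * (1 / ε ^ (m + 1)) ∧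
      I.bound d ε (stages (I.stageConst γ ξ) d ε) ≤ C * (1 / ε ^ (m + 1)) ∧
      (I.run γ ξ d ε).ReachesWithin (stages (128 * I.Δ γ ξ d ε) d ε) (C * ε)
        (C * (1 / ε ^ (m + 1))) ∧
      (I.run γ ξ d (I.accFactor γ ξ * ε)).ReachesWithin (stages (I.stageConst γ ξ) d ε) ε
        (C * (1 / ε ^ (m + 1))) := by
  have hD := h.gapBound_pos
  have hC₀ := h.rateConst_pos
  have hC₁ := div_pos hC₀ h.accFactor_pos
  obtain ⟨B, hB, hbound⟩ := h.exists_bound_stages_le hpoly hsharp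
  set C₀ := rateConst N (eta I.W) γ ξ
  set C₁ := C₀ / I.accFactor γ ξ
  set D := I.gapBound
  refine ⟨B + C₀ * B + C₁ * B + C₀ * D, by positivity, fun d ε hd hA => ?_⟩
  have hε := hA.2.1
  have hΔ := Δ_le_gapBound (h.run_one hA)
  obtain ⟨hB₁, hB₂⟩ := hbound d ε hd hA
  have hle {c b : ℝ} (hb : b ≤ B * (1 / ε ^ (m + 1))) (hc : 0 ≤ c)
      (hcC : c * B ≤ B + C₀ * B + C₁ * B + C₀ * D) :
      c * b ≤ (B + C₀ * B + C₁ * B + C₀ * D) * (1 / ε ^ (m + 1)) :=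
    calc c * b ≤ c * B * (1 / ε ^ (m + 1)) := by rw [mul_assoc]; gcongr
      _ ≤ _ := by gcongr
  have hC₀B := mul_pos hC₀ hB
  have hC₁B := mul_pos hC₁ hB
  have hC₀D := mul_pos hC₀ hD
  refine ⟨?_, ?_, (h.reachesWithin hA).mono ?_ (hle hB₁ hC₀.le (by linarith)),
    (h.reachesWithin_accFactor hA).mono le_rfl (hle hB₂ hC₁.le (by linarith))⟩
  · simpa only [one_mul] using hle hB₁ zero_le_one (by linarith)
  · simpa only [one_mul] using hle hB₂ zero_le_one (by linarith)
  · gcongr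
    linarith [mul_le_mul_of_nonneg_left hΔ hC₀.le]

end Instance

end Magenta

end

theorem corollary1_general (N : ℕ) (hN : 0 < N) (η γ ξ : ℝ) (hγ : 0 < γ) (hξ : 0 < ξ)
    (hγη : (1 + γ) * η ^ 2 < 1) (hξη : (1 + ξ) * η ^ 2 < 1) :
    ∃ C₀ : ℝ, 0 < C₀ ∧
    ∀ (K : ℕ) (I : Magenta.Instance N K),
      I.W ∈ doublyStochastic ℝ (Fin N) → Magenta.eta I.W = η →
      Magenta.ProblemAssumption I.f I.L I.Li I.flow →
      (∀ d ε : ℝ, I.Admissible γ d ε →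
        (I.run γ ξ d ε).ReachesWithin (Magenta.stages (128 * I.Δ γ ξ d ε) d ε)
          (C₀ * I.Δ γ ξ d ε * ε)
          (C₀ * I.bound d ε (Magenta.stages (128 * I.Δ γ ξ d ε) d ε))) ∧
      (∃ κ M C₁ : ℝ, 0 < κ ∧ 0 < M ∧ 0 < C₁ ∧
        (∀ d ε : ℝ, I.Admissible γ d ε →
          (I.run γ ξ d (κ * ε)).ReachesWithin (Magenta.stages M d ε) ε
            (C₁ * I.bound d ε (Magenta.stages M d ε))) ∧
        (∀ Q : ℕ, 2 ≤ Q → I.IsPoly Q → Magenta.SharpConstants I.f I.Li →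
          ∃ C₂ : ℝ, 0 < C₂ ∧ ∀ d ε : ℝ, d = 1 / √ε → I.Admissible γ d ε →
            I.bound d ε (Magenta.stages (128 * I.Δ γ ξ d ε) d ε) ≤ C₂ * (1 / ε ^ (Q - 1)) ∧
            I.bound d ε (Magenta.stages M d ε) ≤ C₂ * (1 / ε ^ (Q - 1)) ∧
            (I.run γ ξ d ε).ReachesWithin (Magenta.stages (128 * I.Δ γ ξ d ε) d ε)
              (C₂ * ε) (C₂ * (1 / ε ^ (Q - 1))) ∧
            (I.run γ ξ d (κ * ε)).ReachesWithin (Magenta.stages M d ε)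
              ε (C₂ * (1 / ε ^ (Q - 1))))) := by
  have : NeZero N := ⟨hN.ne'⟩
  refine ⟨Magenta.rateConst N η γ ξ, Magenta.rateConst_pos hγ hξ hγη hξη, fun K I hW hη hprob => ?_⟩
  subst hη
  have h : I.StandingAssumption γ ξ := ⟨hγ, hξ, hγη, hξη, hW, hprob⟩
  refine ⟨fun d ε => h.reachesWithin, I.accFactor γ ξ, I.stageConst γ ξ, _, h.accFactor_pos,
    h.stageConst_pos, div_pos h.rateConst_pos h.accFactor_pos,
    fun d ε => h.reachesWithin_accFactor, fun Q hQ hpoly hsharp => ?_⟩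
  obtain ⟨m, rfl⟩ := Nat.exists_eq_add_of_le' hQ
  exact h.exists_rate hpoly hsharp

theorem corollary1 (N : ℕ) (hN : 0 < N) (η γ ξ : ℝ) (hγ : 0 < γ) (hξ : 0 < ξ)
    (hγη : (1 + γ) * η ^ 2 < 1) (hξη : (1 + ξ) * η ^ 2 < 1) :
    -- the constant `C₀` depends on `N`, `η`, `γ`, `ξ` only
    ∃ C₀ : ℝ, 0 < C₀ ∧
    ∀ (K : ℕ) (I : Magenta.Instance N K) (G : SimpleGraph (Fin N)),
      Magenta.MixingMatrix G I.W → Magenta.eta I.W = η →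
      Magenta.ProblemAssumption I.f I.L I.Li I.flow →
      -- accuracy parameter `ε` and explicit constant `128 (P(w⁰; 1) - flow)`: gap `O(ε)`
      (∀ d ε : ℝ, I.Admissible γ d ε →
        (I.run γ ξ d ε).ReachesWithin (Magenta.stages (128 * I.Δ γ ξ d ε) d ε)
          (C₀ * I.Δ γ ξ d ε * ε)
          (C₀ * I.bound d ε (Magenta.stages (128 * I.Δ γ ξ d ε) d ε))) ∧
      -- accuracy parameter `κ ε`: gap at most `ε`; the constants do not depend on `d` and `ε`
      (∃ κ M C₁ : ℝ, 0 < κ ∧ 0 < M ∧ 0 < C₁ ∧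
        (∀ d ε : ℝ, I.Admissible γ d ε →
          (I.run γ ξ d (κ * ε)).ReachesWithin (Magenta.stages M d ε) ε
            (C₁ * I.bound d ε (Magenta.stages M d ε))) ∧
        -- polynomials of degree at most `Q`, with `d = 1 / √ε`
        (∀ Q : ℕ, 2 ≤ Q → I.IsPoly Q → Magenta.SharpConstants I.f I.Li →
          ∃ C₂ : ℝ, 0 < C₂ ∧ ∀ d ε : ℝ, d = 1 / √ε → I.Admissible γ d ε →
            I.bound d ε (Magenta.stages (128 * I.Δ γ ξ d ε) d ε) ≤ C₂ * (1 / ε ^ (Q - 1)) ∧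
            I.bound d ε (Magenta.stages M d ε) ≤ C₂ * (1 / ε ^ (Q - 1)) ∧
            (I.run γ ξ d ε).ReachesWithin (Magenta.stages (128 * I.Δ γ ξ d ε) d ε)
              (C₂ * ε) (C₂ * (1 / ε ^ (Q - 1))) ∧
            (I.run γ ξ d (κ * ε)).ReachesWithin (Magenta.stages M d ε)
              ε (C₂ * (1 / ε ^ (Q - 1))))) :=
  (corollary1_general N hN η γ ξ hγ hξ hγη hξη).imp fun _ hC₀ => ⟨hC₀.1, fun K I _ hW =>
    hC₀.2 K I (Magenta.MixingMatrix.mem_doublyStochastic hW)⟩
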